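/- Let $(E,d)$ be a complete separable metric space, $E_1'$ a Borel subset of $\mathbb{R}^e$, $E_2'$ a Polish space, and $F:E\times E_1'\times E_2'\to E$ a measurable map. On a probability space let $Z=(Z_t)_{t\in\mathbb{Z}}$ be a stationary and ergodic process with values in $E_1'$, and let $(\varepsilon_t)_{t\in\mathbb{Z}}$ be i.i.d. random variables with values in $E_2'$ such that the process $(\varepsilon_t)_{t\in\mathbb{Z}}$ is independent of $Z$. Put $f_t(x)=F(x,Z_{t-1},\varepsilon_t)$, $f_{t-s}^t=f_t\circ f_{t-1}\circ\cdots\circ f_{t-s}$ for $s\ge 0$, and $\mathcal{F}_t=\sigma\left((Z_j,\varepsilon_j):j\le t\right)$; write $\log^+ x=\max(\log x,0)$ for $x>0$ and $\log^+0=0$. Conditional expectations of nonnegative random variables take values in $[0,\infty]$. Let $p\ge 1$ and $x_0\in E$ be such that $\mathbb{E}\left[d^p(F(x_0,z,\varepsilon_1),x_0)\right]<\infty$ for every $z\in E_1'$. Suppose that there is a measurable function $\kappa:E_1'\to(0,\infty)$ with $\mathbb{E}\log^+\kappa(Z_0)<\infty$ and $\mathbb{E}\log\kappa(Z_0)<0$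 (the value $-\infty$ is allowed), such that $$\mathbb{E}\left[d^p\left(F(x,z,\varepsilon_0),F(y,z,\varepsilon_0)\right)\right]\le\kappa^p(z)\,d^p(x,y)\qquad\text{for all }x,y\in E,\ z\in E_1',$$ and suppose that $\mathbb{E}\left[\log^+\int d^p\left(x_0,F(x_0,Z_0,u)\right)d\mathbb{P}_{\varepsilon_1}(u)\right]<\infty$, where $\mathbb{P}_{\varepsilon_1}$ is the law of $\varepsilon_1$. Then: 1. For every $(x,t)\in E\times\mathbb{Z}$ there is an $E$-valued random variable $X_t(x)$ such that almost surely $\mathbb{E}\left[d^p(X_t(x),x_0)\mid Z\right]<\infty$, $\lim_{s\to\infty}\mathbb{E}\left[d^p(f_{t-s}^t(x),X_t(x))\mid Z\right]=0$, and $\lim_{s\to\infty}f_{t-s}^t(x)=X_t(x)$. 2. For $x\ne y$ and every $t$, $\mathbb{P}(X_t(x)\ne X_t(y))=0$. Write $X_t=X_t(x)$ (for any choice of $x$). 3. The process $((X_t,Z_t))_{t\in\mathbb{Z}}$ is stationary and ergodic. 4. Call a process $(Y_t)_{t\in\mathbb{Z}}$ admissible if it is non-anticipative ($Y_t$ is $\mathcal{F}_t$-measurable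 for every $t$), $((Y_t,Z_t))_{t\in\mathbb{Z}}$ is stationary, $Y_t=f_t(Y_{t-1})$ a.s. for every $t\in\mathbb{Z}$, and $\mathbb{E}\left[d^p(Y_0,x_0)\mid Z_0,Z_{-1},\ldots\right]<\infty$ a.s. The variables $X_t(x)$ can be chosen so that $(X_t)_{t\in\mathbb{Z}}$ is admissible, and every admissible process satisfies $Y_t=X_t$ a.s. for every $t\in\mathbb{Z}$. -/

import Mathlib

open MeasureTheory ProbabilityTheory Filter Topology
open scoped ENNReal

namespace ExoMaps

noncomputable section

/-- The expectation `∫⁻ f⁺ - ∫⁻ f⁻`, with values in `[-∞, ∞]`, of a real random variable `f`;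
it is meaningful as soon as one of the two parts has a finite integral. -/
def extMean {Ω : Type*} [MeasurableSpace Ω] (μ : Measure Ω) (f : Ω → ℝ) : EReal :=
  ((∫⁻ ω, ENNReal.ofReal (f ω) ∂μ : ℝ≥0∞) : EReal)
    - ((∫⁻ ω, ENNReal.ofReal (-f ω) ∂μ : ℝ≥0∞) : EReal)

/-- The trajectory `ω ↦ (X_t(ω))_{t ∈ ℤ}` of a process. -/
def path {Ω S : Type*} (X : ℤ → Ω → S) : Ω → ℤ → S := fun ω t => X t ω

/-- The left shift on bi-infinite sequences. -/
def shift {S : Type*} (u : ℤ → S) : ℤ → S := fun t => u (t + 1)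

/-- Strict stationarity: the law of the trajectory is invariant under every time translation. -/
def IsStationary {Ω S : Type*} [MeasurableSpace Ω] [MeasurableSpace S]
    (μ : Measure Ω) (X : ℤ → Ω → S) : Prop :=
  ∀ h : ℤ, μ.map (path fun t => X (t + h)) = μ.map (path X)

/-- A stationary process is ergodic if the shift is ergodic for the law of its trajectory. -/
def IsStationaryErgodic {Ω S : Type*} [MeasurableSpace Ω] [MeasurableSpace S]
    (μ : Measure Ω) (X : ℤ → Ω → S) : Prop :=
  IsStationary μ X ∧ Ergodic shift (μ.map (path X))

/-- The σ-algebra `σ(X_j : j ≤ t)`. -/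
abbrev pastSigma {Ω S : Type*} [MeasurableSpace S] (X : ℤ → Ω → S) (t : ℤ) : MeasurableSpace Ω :=
  ⨆ j : ℤ, ⨆ _ : j ≤ t, MeasurableSpace.comap (X j) inferInstance

/-- The σ-algebra `σ(X_j : j ∈ ℤ)`. -/
abbrev fullSigma {Ω S : Type*} [MeasurableSpace S] (X : ℤ → Ω → S) : MeasurableSpace Ω :=
  ⨆ j : ℤ, MeasurableSpace.comap (X j) inferInstance

/-- The random maps `f_t(x) = F(x, Z_{t-1}, ε_t)`. -/
def rmap {Ω E E₁ E₂ : Type*} (F : E → E₁ → E₂ → E) (Z : ℤ → Ω → E₁) (ε : ℤ → Ω → E₂)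
    (t : ℤ) (ω : Ω) (x : E) : E :=
  F x (Z (t - 1) ω) (ε t ω)

/-- The backward iterations `f_{t-s}^t(x) = f_t ∘ f_{t-1} ∘ ⋯ ∘ f_{t-s}(x)`, for `s ≥ 0`
(there are `s + 1` maps). -/
def backIter {Ω E E₁ E₂ : Type*} (F : E → E₁ → E₂ → E) (Z : ℤ → Ω → E₁) (ε : ℤ → Ω → E₂)
    (x : E) : ℕ → ℤ → Ω → E
  | 0, t, ω => rmap F Z ε t ω x
  | s + 1, t, ω => rmap F Z ε t ω (backIter F Z ε x s (t - 1) ω)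

/-- `Y` is a non-anticipative solution of `Y_t = F(Y_{t-1}, Z_{t-1}, ε_t)` such that
`((Y_t, Z_t))_t` is stationary and `E[d(Y_0, x₀)^p | Z_0, Z_{-1}, …] < ∞` almost surely. -/
structure IsStationarySolution {Ω E E₁ E₂ : Type*} [MeasurableSpace Ω] [PseudoEMetricSpace E]
    [MeasurableSpace E] [MeasurableSpace E₁] [MeasurableSpace E₂] (μ : Measure Ω)
    (F : E → E₁ → E₂ → E) (Z : ℤ → Ω → E₁) (ε : ℤ → Ω → E₂) (p : ℝ) (x₀ : E)
    (Y : ℤ → Ω → E) : Prop where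
  nonanticipative : ∀ t, Measurable[pastSigma (fun j ω => (Z j ω, ε j ω)) t] (Y t)
  stationary : IsStationary μ (fun t ω => (Y t ω, Z t ω))
  recursion : ∀ t, ∀ᵐ ω ∂μ, Y t ω = rmap F Z ε t ω (Y (t - 1) ω)
  moment : ∀ᵐ ω ∂μ, condLExp (pastSigma Z 0) μ (fun ω' => edist (Y 0 ω') x₀ ^ p) ω < ∞

end

end ExoMaps

set_option linter.unusedSectionVars false

open scoped symmDiff

namespace ExoMaps

/-! ### Algebra and measurability of the backward iterations. -/

section Iterations

variable {Ω Ω' E E₁ E₂ : Type*} {F : E → E₁ → E₂ → E}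

/-! Freeze the covariate path `z`. The random maps are then independent, and the one at time `t`
contracts `L^p` distances by `κ (z (t - 1))`. The iterates of order `s` and `s + 1` from `x₀` are
the same composition of `s + 1` maps, started from `x₀` and from a one-step image of `x₀`. Their
`L^p` distance is therefore at most a product of `s + 1` coefficients times the size of one step
(`lpMean_backIter_succ_le`).

For almost every path these bounds are summable (`ae_isSummablePath`). Since `log κ` has a negative
mean, so has `max (log κ) (-M) + δ` for suitable `M` and `δ > 0`; its Birkhoff sums into the past
are bounded above, and the products decay like `exp (-δ n)`. The logarithmic moment and
Borel–Cantelli make the step sizes grow at most like `exp (δ n / 2)`. Hence the iterates converge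
almost surely and in `L^p`, and changing the starting point costs only a product that tends to zero.

Independence of `Z` and `ε` turns these quenched facts into the theorem: integrals with `Z` frozen
are the conditional expectations (`condLExp_eq_of_indepFun`), and a property that holds almost
surely for almost every frozen path holds almost surely (`ae_of_ae_ae_of_indepFun`).

The limit is a shift-equivariant measurable function of the path of `(Z, ε)`, so ergodicity reduces
to that of the pair (`isStationaryErgodic_zip`). The conditional probability given `Z` of an
invariant event is an invariant function of `Z`, hence a constant `c`; approximation by a cylinder
and by a far translate of it, conditionally independent of it, gives `c = c ^ 2`.

For uniqueness, a solution satisfies `Y_t = f_{t-s}^t (Y_{t-s-1})`. By stationarity `Y_{t-s-1}` is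
tight uniformly in `s`, by non-anticipation it is independent of the later innovations, and the
contraction makes the iterates from `x₀` converge to `Y_t` in probability
(`ae_eq_limIter_of_isStationarySolution`). -/

lemma backIter_congr {Z : ℤ → Ω → E₁} {ε : ℤ → Ω → E₂} {Z' : ℤ → Ω' → E₁} {ε' : ℤ → Ω' → E₂}
    {ω : Ω} {ω' : Ω'} (hZ : ∀ j, Z j ω = Z' j ω') (hε : ∀ j, ε j ω = ε' j ω') (x : E) (s : ℕ)
    (t : ℤ) : backIter F Z ε x s t ω = backIter F Z' ε' x s t ω' := by
  induction s generalizing t with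
  | zero => simp [backIter, rmap, hZ, hε]
  | succ s ih => simp [backIter, rmap, hZ, hε, ih]

lemma backIter_shift (Z : ℤ → Ω → E₁) (ε : ℤ → Ω → E₂) (h : ℤ) (x : E) (s : ℕ) (t : ℤ) (ω : Ω) :
    backIter F (fun j => Z (j + h)) (fun j => ε (j + h)) x s t ω
      = backIter F Z ε x s (t + h) ω := by
  induction s generalizing t with
  | zero => simp [backIter, rmap, sub_add_eq_add_sub]
  | succ s ih => simp [backIter, rmap, ih, sub_add_eq_add_sub]

/-- The recursive definition peels off the most recent map, whereas this peels off the oldest one: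
consecutive iterates become one composition applied to two starting points. -/
lemma backIter_succ_eq (Z : ℤ → Ω → E₁) (ε : ℤ → Ω → E₂) (x : E) (s : ℕ) (t : ℤ) (ω : Ω) :
    backIter F Z ε x (s + 1) t ω = backIter F Z ε (rmap F Z ε (t - s - 1) ω x) s t ω := by
  induction s generalizing t with
  | zero => simp [backIter]
  | succ s ih =>
    rw [backIter, ih]
    conv_rhs => rw [backIter]
    rw [show t - 1 - (s : ℤ) - 1 = t - ((s + 1 : ℕ) : ℤ) - 1 by push_cast; ring]

variable [MeasurableSpace E] [MeasurableSpace E₁] [MeasurableSpace E₂]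

lemma measurable_backIter {m : MeasurableSpace Ω}
    (hF : Measurable fun q : E × E₁ × E₂ => F q.1 q.2.1 q.2.2)
    {Z : ℤ → Ω → E₁} {ε : ℤ → Ω → E₂} {U : Ω → E} (hU : Measurable U) (s : ℕ) {t : ℤ}
    (hZ : ∀ j ≤ t - 1, Measurable (Z j)) (hε : ∀ j ≤ t, Measurable (ε j)) :
    Measurable fun ω => backIter F Z ε (U ω) s t ω := by
  induction s generalizing t with
  | zero =>
    exact hF.comp (hU.prodMk ((hZ _ le_rfl).prodMk (hε _ le_rfl)))
  | succ s ih =>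
    have := ih (t := t - 1) (fun j hj => hZ j (by omega)) (fun j hj => hε j (by omega))
    exact hF.comp (this.prodMk ((hZ _ le_rfl).prodMk (hε _ le_rfl)))

end Iterations

/-! ### Independence of σ-algebras and integration of independent pairs. -/

section Independence

variable {Ω : Type*} {mΩ : MeasurableSpace Ω} {μ : Measure Ω}

/-- The sets `a ∩ b` form a π-system generating `A ⊔ B`, and on them `P(a ∩ b ∩ c) = P(a) P(b ∩ c) =
P(a) P(b) P(c) = P(a ∩ b) P(c)`. -/
lemma indep_sup_left {A B C : MeasurableSpace Ω} [IsProbabilityMeasure μ]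
    (hA : A ≤ mΩ) (hB : B ≤ mΩ) (hC : C ≤ mΩ) (hABC : Indep A (B ⊔ C) μ) (hBC : Indep B C μ) :
    Indep (A ⊔ B) C μ := by
  let π : Set (Set Ω) := {s | ∃ a b, MeasurableSet[A] a ∧ MeasurableSet[B] b ∧ s = a ∩ b}
  have hπ : IsPiSystem π := by
    rintro _ ⟨a, b, ha, hb, rfl⟩ _ ⟨a', b', ha', hb', rfl⟩ -
    exact ⟨a ∩ a', b ∩ b', ha.inter ha', hb.inter hb', Set.inter_inter_inter_comm ..⟩
  have hgen : A ⊔ B = MeasurableSpace.generateFrom π := by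
    apply le_antisymm
    · refine sup_le (fun a ha => ?_) (fun b hb => ?_)
      · exact MeasurableSpace.measurableSet_generateFrom
          ⟨a, Set.univ, ha, MeasurableSet.univ, by simp⟩
      · exact MeasurableSpace.measurableSet_generateFrom
          ⟨Set.univ, b, MeasurableSet.univ, hb, by simp⟩
    · refine MeasurableSpace.generateFrom_le ?_
      rintro _ ⟨a, b, ha, hb, rfl⟩
      exact MeasurableSet.inter (le_sup_left (a := A) (b := B) _ ha)
        (le_sup_right (a := A) (b := B) _ hb)
  refine IndepSets.indep (sup_le hA hB) hC hπ (@MeasurableSpace.isPiSystem_measurableSet Ω C)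
    hgen (@MeasurableSpace.generateFrom_measurableSet Ω C).symm ?_
  rw [IndepSets_iff]
  rintro _ c ⟨a, b, ha, hb, rfl⟩ hc
  rw [Indep_iff] at hABC hBC
  have hb' : MeasurableSet[B ⊔ C] b := le_sup_left (a := B) (b := C) _ hb
  have hc' : MeasurableSet[B ⊔ C] c := le_sup_right (a := B) (b := C) _ hc
  rw [Set.inter_assoc, hABC a _ ha (hb'.inter hc'), hBC b c hb hc, hABC a b ha hb', mul_assoc]

lemma lintegral_comp_of_indepFun [IsProbabilityMeasure μ] {S T : Type*} [MeasurableSpace S]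
    [MeasurableSpace T]
    {X : Ω → S} {Y : Ω → T} (hX : Measurable X) (hY : Measurable Y) (hXY : IndepFun X Y μ)
    {G : S × T → ℝ≥0∞} (hG : Measurable G) :
    ∫⁻ ω, G (X ω, Y ω) ∂μ = ∫⁻ ω, ∫⁻ ω', G (X ω, Y ω') ∂μ ∂μ := by
  have h := (indepFun_iff_map_prod_eq_prod_map_map hX.aemeasurable hY.aemeasurable).1 hXY
  have : IsProbabilityMeasure (μ.map Y) := Measure.isProbabilityMeasure_map hY.aemeasurable
  rw [← lintegral_map hG (hX.prodMk hY), h, lintegral_prod _ hG.aemeasurable,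
    lintegral_map hG.lintegral_prod_right' hX]
  refine lintegral_congr fun ω => ?_
  rw [lintegral_map (by fun_prop) hY]

end Independence

/-! ### Contraction of the iterations in mean, with weights that depend on the covariates. -/

section Contraction

variable {Ω E₁ E₂ : Type*} {mΩ : MeasurableSpace Ω} {μ : Measure Ω}
  [MeasurableSpace E₁] [MeasurableSpace E₂] {Z : ℤ → Ω → E₁} {ε : ℤ → Ω → E₂}

lemma fullSigma_eq_comap (Z : ℤ → Ω → E₁) :
    fullSigma Z = MeasurableSpace.comap (path Z) MeasurableSpace.pi := by
  simp only [fullSigma, MeasurableSpace.pi, MeasurableSpace.comap_iSup, MeasurableSpace.comap_comp]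
  rfl

lemma fullSigma_le (hZ : ∀ t, Measurable (Z t)) : fullSigma Z ≤ mΩ :=
  iSup_le fun j => (hZ j).comap_le

lemma pastSigma_le (hZ : ∀ t, Measurable (Z t)) (t : ℤ) : pastSigma Z t ≤ mΩ :=
  iSup₂_le fun j _ => (hZ j).comap_le

lemma pastSigma_le_fullSigma (Z : ℤ → Ω → E₁) (t : ℤ) : pastSigma Z t ≤ fullSigma Z :=
  iSup_mono fun _ => iSup_le fun _ => le_rfl

lemma pastSigma_mono (Z : ℤ → Ω → E₁) {s t : ℤ} (h : s ≤ t) : pastSigma Z s ≤ pastSigma Z t :=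
  iSup_mono fun _ => iSup_le fun hj => le_iSup_of_le (hj.trans h) le_rfl

lemma measurable_pastSigma (Z : ℤ → Ω → E₁) {j t : ℤ} (h : j ≤ t) :
    Measurable[pastSigma Z t] (Z j) :=
  measurable_iff_comap_le.2 (le_iSup₂_of_le j h le_rfl)

lemma measurable_fullSigma (Z : ℤ → Ω → E₁) (j : ℤ) : Measurable[fullSigma Z] (Z j) :=
  measurable_iff_comap_le.2 (le_iSup_of_le j le_rfl)

/-- The information carried by all the covariates and by the innovations up to time `t`. -/
abbrev jointSigma (Z : ℤ → Ω → E₁) (ε : ℤ → Ω → E₂) (t : ℤ) : MeasurableSpace Ω :=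
  fullSigma Z ⊔ pastSigma ε t

/-- The whole covariate path, future included, may be conditioned on because it is independent of
all innovations. -/
lemma indep_jointSigma [IsProbabilityMeasure μ] (hZ : ∀ t, Measurable (Z t))
    (hε : ∀ t, Measurable (ε t)) (hεindep : iIndepFun ε μ)
    (hZε : IndepFun (path Z) (path ε) μ) (t : ℤ) :
    Indep (jointSigma Z ε (t - 1)) (MeasurableSpace.comap (ε t) inferInstance) μ := by
  refine indep_sup_left (fullSigma_le hZ) (pastSigma_le hε _) (hε t).comap_le ?_ ?_
  · have : Indep (fullSigma Z) (fullSigma ε) μ := by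
      rw [fullSigma_eq_comap, fullSigma_eq_comap]; exact hZε
    refine indep_of_indep_of_le_right this (sup_le (pastSigma_le_fullSigma _ _) ?_)
    exact le_iSup_of_le t le_rfl
  · have := indep_iSup_of_disjoint (m := fun j => MeasurableSpace.comap (ε j) inferInstance)
      (fun j => (hε j).comap_le) hεindep (S := Set.Iic (t - 1)) (T := {t}) (by simp)
    simpa only [Set.mem_Iic, Set.mem_singleton_iff, iSup_iSup_eq_left] using this

variable [IsProbabilityMeasure μ] {E : Type*} [PseudoEMetricSpace E] [SecondCountableTopology E]
  [MeasurableSpace E] [OpensMeasurableSpace E] {F : E → E₁ → E₂ → E} {p : ℝ} {K : E₁ → ℝ≥0∞}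

lemma measurable_edist_step (hF : Measurable fun q : E × E₁ × E₂ => F q.1 q.2.1 q.2.2)
    {e : Ω → E₂} (he : Measurable e) (z : E₁) (x y : E) :
    Measurable fun ω => edist (F x z (e ω)) (F y z (e ω)) ^ p := by
  have h1 (x : E) : Measurable fun ω' => F x z (e ω') :=
    hF.comp (g := fun q : E × E₁ × E₂ => F q.1 q.2.1 q.2.2)
      (f := fun ω' => (x, z, e ω')) (by fun_prop)
  exact ((h1 _).edist (h1 _)).pow_const p

/-- Since `e` is independent of `G`, everything `G`-measurable can be frozen while `hK` is
integrated over `e`. The weight `w` serves to carry the coefficients already collected, and later an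
indicator. -/
lemma lintegral_edist_step_le (hF : Measurable fun q : E × E₁ × E₂ => F q.1 q.2.1 q.2.2)
    {e : Ω → E₂} (he : Measurable e)
    (hK : ∀ z x y, ∫⁻ ω, edist (F x z (e ω)) (F y z (e ω)) ^ p ∂μ ≤ K z ^ p * edist x y ^ p)
    {G : MeasurableSpace Ω} (hG : G ≤ mΩ)
    (hGe : Indep G (MeasurableSpace.comap e inferInstance) μ)
    {w : Ω → ℝ≥0∞} {ζ : Ω → E₁} {U V : Ω → E} (hw : Measurable[G] w) (hζ : Measurable[G] ζ)
    (hU : Measurable[G] U) (hV : Measurable[G] V) :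
    ∫⁻ ω, w ω * edist (F (U ω) (ζ ω) (e ω)) (F (V ω) (ζ ω) (e ω)) ^ p ∂μ
      ≤ ∫⁻ ω, w ω * K (ζ ω) ^ p * edist (U ω) (V ω) ^ p ∂μ := by
  have hT : Measurable[G] fun ω => (w ω, ζ ω, U ω, V ω) := hw.prodMk (hζ.prodMk (hU.prodMk hV))
  have hind : IndepFun (fun ω => (w ω, ζ ω, U ω, V ω)) e μ :=
    indep_of_indep_of_le_left hGe hT.comap_le
  have hΦ : Measurable fun q : (ℝ≥0∞ × E₁ × E × E) × E₂ =>
      q.1.1 * edist (F q.1.2.2.1 q.1.2.1 q.2) (F q.1.2.2.2 q.1.2.1 q.2) ^ p := by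
    have h1 : Measurable fun q : (ℝ≥0∞ × E₁ × E × E) × E₂ => F q.1.2.2.1 q.1.2.1 q.2 :=
      hF.comp (g := fun q : E × E₁ × E₂ => F q.1 q.2.1 q.2.2)
        (f := fun q : (ℝ≥0∞ × E₁ × E × E) × E₂ => (q.1.2.2.1, q.1.2.1, q.2)) (by fun_prop)
    have h2 : Measurable fun q : (ℝ≥0∞ × E₁ × E × E) × E₂ => F q.1.2.2.2 q.1.2.1 q.2 :=
      hF.comp (g := fun q : E × E₁ × E₂ => F q.1 q.2.1 q.2.2)
        (f := fun q : (ℝ≥0∞ × E₁ × E × E) × E₂ => (q.1.2.2.2, q.1.2.1, q.2)) (by fun_prop)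
    exact measurable_fst.fst.mul ((h1.edist h2).pow_const p)
  rw [lintegral_comp_of_indepFun (hT.mono hG le_rfl) he hind hΦ]
  refine lintegral_mono fun ω => ?_
  dsimp only
  rw [lintegral_const_mul]
  · rw [mul_assoc]
    gcongr
    exact hK _ _ _
  · exact measurable_edist_step hF he _ _ _

lemma lintegral_edist_backIter_le
    (hF : Measurable fun q : E × E₁ × E₂ => F q.1 q.2.1 q.2.2)
    (hZ : ∀ t, Measurable (Z t)) (hε : ∀ t, Measurable (ε t)) (hεindep : iIndepFun ε μ)
    (hZε : IndepFun (path Z) (path ε) μ) (hKm : Measurable K)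
    (hK : ∀ t z x y,
      ∫⁻ ω, edist (F x z (ε t ω)) (F y z (ε t ω)) ^ p ∂μ ≤ K z ^ p * edist x y ^ p)
    (s : ℕ) (t : ℤ) {w : Ω → ℝ≥0∞} {U V : Ω → E} (hw : Measurable[fullSigma Z] w)
    (hU : Measurable[jointSigma Z ε (t - s - 1)] U)
    (hV : Measurable[jointSigma Z ε (t - s - 1)] V) :
    ∫⁻ ω, w ω * edist (backIter F Z ε (U ω) s t ω) (backIter F Z ε (V ω) s t ω) ^ p ∂μ
      ≤ ∫⁻ ω, w ω * (∏ j ∈ Finset.range (s + 1), K (Z (t - 1 - j) ω) ^ p)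
          * edist (U ω) (V ω) ^ p ∂μ := by
  have hle (t : ℤ) : jointSigma Z ε t ≤ mΩ := sup_le (fullSigma_le hZ) (pastSigma_le hε _)
  have hZm (t j : ℤ) : Measurable[jointSigma Z ε t] (Z j) :=
    (measurable_fullSigma Z j).mono le_sup_left le_rfl
  have hεm (t j : ℤ) (h : j ≤ t) : Measurable[jointSigma Z ε t] (ε j) :=
    (measurable_pastSigma ε h).mono le_sup_right le_rfl
  have hwm {w : Ω → ℝ≥0∞} (hw : Measurable[fullSigma Z] w) (t : ℤ) :
      Measurable[jointSigma Z ε t] w := hw.mono le_sup_left le_rfl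
  induction s generalizing t w with
  | zero =>
    rw [show t - ((0 : ℕ) : ℤ) - 1 = t - 1 by simp] at hU hV
    have := lintegral_edist_step_le hF (hε t) (hK t) (hle (t - 1))
      (indep_jointSigma hZ hε hεindep hZε t) (hwm hw _) (hZm _ (t - 1)) hU hV
    simpa [backIter, rmap] using this
  | succ s ih =>
    have hmono : jointSigma Z ε (t - (s + 1 : ℕ) - 1) ≤ jointSigma Z ε (t - 1) :=
      sup_le_sup le_rfl (pastSigma_mono _ (by omega))
    have hb {U : Ω → E} (hU : Measurable[jointSigma Z ε (t - (s + 1 : ℕ) - 1)] U) :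
        Measurable[jointSigma Z ε (t - 1)] fun ω => backIter F Z ε (U ω) s (t - 1) ω :=
      measurable_backIter hF (hU.mono hmono le_rfl) s (fun j _ => hZm _ j)
        (fun j hj => hεm _ j hj)
    have h1 := lintegral_edist_step_le hF (hε t) (hK t) (hle (t - 1))
      (indep_jointSigma hZ hε hεindep hZε t) (hwm hw _) (hZm _ (t - 1)) (hb hU) (hb hV)
    have e : t - ((s + 1 : ℕ) : ℤ) - 1 = t - 1 - s - 1 := by push_cast; ring
    rw [e] at hU hV
    -- The coefficient of the map just removed joins the weight, which stays a function of the
    -- covariates alone.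
    have h2 := ih (t - 1) (w := fun ω => w ω * K (Z (t - 1) ω) ^ p)
      (hw.mul ((hKm.comp (measurable_fullSigma Z _)).pow_const p)) hU hV
    refine (h1.trans h2).trans (le_of_eq (lintegral_congr fun ω => ?_))
    rw [Finset.prod_range_succ' _ (s + 1)]
    have : ∀ j : ℕ, t - 1 - ((j + 1 : ℕ) : ℤ) = t - 1 - 1 - j := fun j => by push_cast; ring
    simp only [this, Nat.cast_zero, sub_zero]
    ring

end Contraction

/-! ### `L^p` distances between random points, and convergence from summable increments. -/

section LpMean

variable {Ω : Type*} {mΩ : MeasurableSpace Ω} {μ : Measure Ω} {p : ℝ}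

/-- The `L^p` norm of a nonnegative function. -/
noncomputable def lpMean (μ : Measure Ω) (p : ℝ) (f : Ω → ℝ≥0∞) : ℝ≥0∞ :=
  (∫⁻ ω, f ω ^ p ∂μ) ^ (1 / p)

lemma lpMean_rpow (hp : 1 ≤ p) (f : Ω → ℝ≥0∞) : lpMean μ p f ^ p = ∫⁻ ω, f ω ^ p ∂μ := by
  rw [lpMean, ← ENNReal.rpow_mul, one_div_mul_cancel (by linarith), ENNReal.rpow_one]

lemma lpMean_le_of_lintegral_le (hp : 1 ≤ p) {f : Ω → ℝ≥0∞} {a : ℝ≥0∞}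
    (h : ∫⁻ ω, f ω ^ p ∂μ ≤ a ^ p) : lpMean μ p f ≤ a := by
  rw [← lpMean_rpow hp] at h
  exact (ENNReal.rpow_le_rpow_iff (by linarith)).1 h

lemma lpMean_add_le (hp : 1 ≤ p) {f g : Ω → ℝ≥0∞} (hf : Measurable f) (hg : Measurable g) :
    lpMean μ p (fun ω => f ω + g ω) ≤ lpMean μ p f + lpMean μ p g :=
  ENNReal.lintegral_Lp_add_le hf.aemeasurable hg.aemeasurable hp

lemma lpMean_mono (hp : 1 ≤ p) {f g : Ω → ℝ≥0∞} (h : ∀ᵐ ω ∂μ, f ω ≤ g ω) :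
    lpMean μ p f ≤ lpMean μ p g :=
  ENNReal.rpow_le_rpow (lintegral_mono_ae (h.mono fun _ hω =>
    ENNReal.rpow_le_rpow hω (by linarith))) (by positivity)

lemma lintegral_le_lpMean [IsProbabilityMeasure μ] (hp : 1 ≤ p) {f : Ω → ℝ≥0∞}
    (hf : Measurable f) : ∫⁻ ω, f ω ∂μ ≤ lpMean μ p f := by
  simpa [eLpNorm', lpMean] using
    eLpNorm'_le_eLpNorm'_of_exponent_le one_pos hp μ hf.aestronglyMeasurable

lemma tendsto_lintegral_rpow_of_lpMean (hp : 1 ≤ p) {f : ℕ → Ω → ℝ≥0∞}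
    (h : Tendsto (fun n => lpMean μ p (f n)) atTop (𝓝 0)) :
    Tendsto (fun n => ∫⁻ ω, f n ω ^ p ∂μ) atTop (𝓝 0) := by
  have := (ENNReal.continuous_rpow_const (y := p)).tendsto 0 |>.comp h
  rw [ENNReal.zero_rpow_of_pos (by linarith)] at this
  simpa [Function.comp_def, lpMean_rpow hp] using this

variable {E : Type*} [MetricSpace E] [SecondCountableTopology E]
  [MeasurableSpace E] [BorelSpace E]

lemma lpMean_edist_triangle (hp : 1 ≤ p) {f g h : Ω → E} (hf : Measurable f) (hg : Measurable g)
    (hh : Measurable h) : lpMean μ p (fun ω => edist (f ω) (h ω))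
      ≤ lpMean μ p (fun ω => edist (f ω) (g ω)) + lpMean μ p (fun ω => edist (g ω) (h ω)) :=
  (lpMean_mono hp (ae_of_all _ fun _ => edist_triangle _ _ _)).trans
    (lpMean_add_le hp (hf.edist hg) (hg.edist hh))

lemma ae_eq_of_lpMean_edist_eq_zero (hp : 1 ≤ p) {f g : Ω → E} (hf : Measurable f)
    (hg : Measurable g) (h : lpMean μ p (fun ω => edist (f ω) (g ω)) = 0) :
    ∀ᵐ ω ∂μ, f ω = g ω := by
  have h1 : ∫⁻ ω, edist (f ω) (g ω) ^ p ∂μ = 0 := by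
    rw [← lpMean_rpow hp, h, ENNReal.zero_rpow_of_pos (by linarith)]
  rw [lintegral_eq_zero_iff ((hf.edist hg).pow_const p)] at h1
  filter_upwards [h1] with ω hω
  have := (ENNReal.rpow_eq_zero_iff_of_pos (by linarith)).1 hω
  simpa using this

variable {f : ℕ → Ω → E} {a : ℕ → ℝ≥0∞}

lemma lpMean_edist_le_sum (hp : 1 ≤ p) (hf : ∀ n, Measurable (f n))
    (ha : ∀ n, lpMean μ p (fun ω => edist (f n ω) (f (n + 1) ω)) ≤ a n) (s n : ℕ) :
    lpMean μ p (fun ω => edist (f s ω) (f (s + n) ω)) ≤ ∑ k ∈ Finset.range n, a (s + k) := by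
  induction n with
  | zero => simp [lpMean, ENNReal.zero_rpow_of_pos (show 0 < p by linarith),
      ENNReal.zero_rpow_of_pos (show 0 < p⁻¹ by positivity)]
  | succ n ih =>
    rw [Finset.sum_range_succ]
    exact (lpMean_edist_triangle hp (hf _) (hf _) (hf _)).trans (add_le_add ih (ha _))

lemma ae_exists_tendsto_of_tsum_lpMean [CompleteSpace E] [IsProbabilityMeasure μ] (hp : 1 ≤ p)
    (hf : ∀ n, Measurable (f n))
    (ha : ∀ n, lpMean μ p (fun ω => edist (f n ω) (f (n + 1) ω)) ≤ a n)
    (hsum : ∑' n, a n ≠ ∞) : ∀ᵐ ω ∂μ, ∃ y, Tendsto (fun n => f n ω) atTop (𝓝 y) := by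
  have hm : ∀ n, Measurable fun ω => edist (f n ω) (f (n + 1) ω) :=
    fun n => (hf n).edist (hf _)
  have h1 : ∫⁻ ω, ∑' n, edist (f n ω) (f (n + 1) ω) ∂μ ≠ ∞ := by
    rw [lintegral_tsum fun n => (hm n).aemeasurable]
    exact ne_top_of_le_ne_top hsum
      (ENNReal.tsum_le_tsum fun n => (lintegral_le_lpMean hp (hm n)).trans (ha n))
  filter_upwards [ae_lt_top (Measurable.tsum hm) h1] with ω hω
  exact cauchySeq_tendsto_of_complete
    (cauchySeq_of_edist_le_of_tsum_ne_top _ (fun _ => le_rfl) hω.ne)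

/-- Fatou's lemma applied to the distances from `f s` to `f (s + n)`, which are bounded by partial
sums of `a` from index `s` on. -/
lemma lpMean_edist_le_tsum (hp : 1 ≤ p) (hf : ∀ n, Measurable (f n))
    (ha : ∀ n, lpMean μ p (fun ω => edist (f n ω) (f (n + 1) ω)) ≤ a n) {L : Ω → E}
    (hL : ∀ᵐ ω ∂μ, Tendsto (fun n => f n ω) atTop (𝓝 (L ω))) (s : ℕ) :
    lpMean μ p (fun ω => edist (f s ω) (L ω)) ≤ ∑' k, a (k + s) := by
  have hp0 : 0 < p := by linarith
  refine lpMean_le_of_lintegral_le hp ?_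
  have h1 : ∀ᵐ ω ∂μ, edist (f s ω) (L ω) ^ p
      = liminf (fun n => edist (f s ω) (f (s + n) ω) ^ p) atTop := by
    filter_upwards [hL] with ω hω
    have h2 : Tendsto (fun n => f (s + n) ω) atTop (𝓝 (L ω)) := by
      simpa only [add_comm s] using (tendsto_add_atTop_iff_nat s).2 hω
    exact (((ENNReal.continuous_rpow_const (y := p)).tendsto _).comp
      (tendsto_const_nhds.edist h2)).liminf_eq.symm
  rw [lintegral_congr_ae h1]
  refine (lintegral_liminf_le fun n => ((hf s).edist (hf _)).pow_const p).trans ?_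
  refine liminf_le_of_frequently_le' (Frequently.of_forall fun n => ?_)
  rw [← lpMean_rpow hp]
  refine ENNReal.rpow_le_rpow ((lpMean_edist_le_sum hp hf ha s n).trans ?_) hp0.le
  simp only [add_comm s]
  exact ENNReal.sum_le_tsum _

lemma ae_tendsto_edist_zero_of_tsum_lpMean [IsProbabilityMeasure μ] (hp : 1 ≤ p)
    {g : ℕ → Ω → E} (hf : ∀ n, Measurable (f n)) (hg : ∀ n, Measurable (g n))
    (ha : ∀ n, lpMean μ p (fun ω => edist (f n ω) (g n ω)) ≤ a n)
    (hsum : ∑' n, a n ≠ ∞) :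
    ∀ᵐ ω ∂μ, Tendsto (fun n => edist (f n ω) (g n ω)) atTop (𝓝 0) := by
  have hm : ∀ n, Measurable fun ω => edist (f n ω) (g n ω) := fun n => (hf n).edist (hg n)
  have h1 : ∫⁻ ω, ∑' n, edist (f n ω) (g n ω) ∂μ ≠ ∞ := by
    rw [lintegral_tsum fun n => (hm n).aemeasurable]
    exact ne_top_of_le_ne_top hsum
      (ENNReal.tsum_le_tsum fun n => (lintegral_le_lpMean hp (hm n)).trans (ha n))
  filter_upwards [ae_lt_top (Measurable.tsum hm) h1] with ω hω
  exact ENNReal.tendsto_atTop_zero_of_tsum_ne_top hω.ne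

end LpMean

/-! ### The limit of the backward iterations. -/

section Limit

variable {Ω Ω' E E₁ E₂ : Type*} [TopologicalSpace E] {F : E → E₁ → E₂ → E}

/-- The limit of the backward iterations started at `x`. -/
noncomputable def limIter (F : E → E₁ → E₂ → E) (Z : ℤ → Ω → E₁) (ε : ℤ → Ω → E₂) (x : E) (t : ℤ)
    (ω : Ω) : E :=
  haveI : Nonempty E := ⟨x⟩
  limUnder atTop fun s => backIter F Z ε x s t ω

lemma limIter_congr {Z : ℤ → Ω → E₁} {ε : ℤ → Ω → E₂} {Z' : ℤ → Ω' → E₁} {ε' : ℤ → Ω' → E₂}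
    {ω : Ω} {ω' : Ω'} (hZ : ∀ j, Z j ω = Z' j ω') (hε : ∀ j, ε j ω = ε' j ω') (x : E)
    (t : ℤ) : limIter F Z ε x t ω = limIter F Z' ε' x t ω' := by
  simp only [limIter, backIter_congr hZ hε]

lemma limIter_shift (Z : ℤ → Ω → E₁) (ε : ℤ → Ω → E₂) (h : ℤ) (x : E) (t : ℤ) (ω : Ω) :
    limIter F (fun j => Z (j + h)) (fun j => ε (j + h)) x t ω
      = limIter F Z ε x (t + h) ω := by
  simp only [limIter, backIter_shift]

lemma tendsto_limIter {Z : ℤ → Ω → E₁} {ε : ℤ → Ω → E₂} {x : E} {t : ℤ} {ω : Ω}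
    (h : ∃ y, Tendsto (fun s => backIter F Z ε x s t ω) atTop (𝓝 y)) :
    Tendsto (fun s => backIter F Z ε x s t ω) atTop (𝓝 (limIter F Z ε x t ω)) :=
  tendsto_nhds_limUnder h

/-- `limUnder` is measurable even where the limit does not exist, and only times up to `t` enter.
With `m` the σ-algebra of the past, this yields exact non-anticipation, not merely up to a null set.
-/
lemma measurable_limIter {Ω E : Type*} [MetricSpace E] [CompleteSpace E]
    [SecondCountableTopology E] [MeasurableSpace E] [BorelSpace E]
    [MeasurableSpace E₁] [MeasurableSpace E₂] {F : E → E₁ → E₂ → E} {m : MeasurableSpace Ω}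
    (hF : Measurable fun q : E × E₁ × E₂ => F q.1 q.2.1 q.2.2)
    {Z : ℤ → Ω → E₁} {ε : ℤ → Ω → E₂} (x : E) {t : ℤ}
    (hZ : ∀ j ≤ t - 1, Measurable (Z j)) (hε : ∀ j ≤ t, Measurable (ε j)) :
    Measurable (limIter F Z ε x t) :=
  (StronglyMeasurable.limUnder (hE := ⟨x⟩) (l := atTop) (f := fun s => backIter F Z ε x s t) fun s =>
    (measurable_backIter hF measurable_const s hZ hε).stronglyMeasurable).measurable

end Limit

/-! ### From frozen covariates to conditional expectations and almost sure statements. -/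

section Conditional

variable {Ω E₁ E₂ : Type*} {mΩ : MeasurableSpace Ω} {μ : Measure Ω} [IsProbabilityMeasure μ]
  [MeasurableSpace E₁] [MeasurableSpace E₂] {Z : ℤ → Ω → E₁} {ε : ℤ → Ω → E₂}

lemma measurable_path {S : Type*} [MeasurableSpace S] {Y : ℤ → Ω → S}
    (hY : ∀ t, Measurable (Y t)) : Measurable (path Y) :=
  measurable_pi_lambda _ hY

/-- Fubini over each event of `m`, which is an event on the path of `Z`. The σ-algebra `m` is left
free so that both the full path and the past of `Z` can be conditioned on. -/
lemma condLExp_eq_of_indepFun (hZ : ∀ t, Measurable (Z t)) (hε : ∀ t, Measurable (ε t))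
    (hZε : IndepFun (path Z) (path ε) μ) {m : MeasurableSpace Ω} (hm : m ≤ fullSigma Z)
    {G : (ℤ → E₁) × (ℤ → E₂) → ℝ≥0∞} (hG : Measurable G)
    (hq : Measurable[m] fun ω => ∫⁻ ω', G (path Z ω, path ε ω') ∂μ) :
    (fun ω => ∫⁻ ω', G (path Z ω, path ε ω') ∂μ)
      =ᵐ[μ] condLExp m μ (fun ω => G (path Z ω, path ε ω)) := by
  have hmΩ : m ≤ mΩ := hm.trans (fullSigma_le hZ)
  refine ae_eq_condLExp hmΩ _ _ hq fun A hA => ?_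
  have hA' := hm A hA
  rw [fullSigma_eq_comap] at hA'
  obtain ⟨B, hB, rfl⟩ := hA'
  have hA' := hmΩ _ hA
  rw [← lintegral_indicator hA', ← lintegral_indicator hA']
  have := lintegral_comp_of_indepFun (measurable_path hZ) (measurable_path hε) hZε
    (G := (Prod.fst ⁻¹' B).indicator G) (hG.indicator (measurable_fst hB))
  simp only [Set.indicator, Set.mem_preimage] at this ⊢
  refine Eq.trans (lintegral_congr fun ω => ?_) this.symm
  by_cases h : path Z ω ∈ B <;> simp [h]

lemma ae_of_ae_ae_of_indepFun (hZ : ∀ t, Measurable (Z t)) (hε : ∀ t, Measurable (ε t))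
    (hZε : IndepFun (path Z) (path ε) μ) {A : Set ((ℤ → E₁) × (ℤ → E₂))} (hA : MeasurableSet A)
    (h : ∀ᵐ ω ∂μ, ∀ᵐ ω' ∂μ, (path Z ω, path ε ω') ∈ A) :
    ∀ᵐ ω ∂μ, (path Z ω, path ε ω) ∈ A := by
  have h1 := lintegral_comp_of_indepFun (measurable_path hZ) (measurable_path hε) hZε
    (G := Aᶜ.indicator 1) (measurable_one.indicator hA.compl)
  have hm (ω : Ω) : Measurable fun ω' => (path Z ω, path ε ω') :=
    measurable_const.prodMk (measurable_path hε)
  have h2 : ∫⁻ ω, ∫⁻ ω', Aᶜ.indicator 1 (path Z ω, path ε ω') ∂μ ∂μ = 0 := by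
    refine (lintegral_congr_ae (h.mono fun ω hω => ?_)).trans lintegral_zero
    refine (lintegral_congr_ae (hω.mono fun ω' hω' => ?_)).trans lintegral_zero
    simp [hω']
  rw [h2] at h1
  filter_upwards [(lintegral_eq_zero_iff ((measurable_one.indicator hA.compl).comp
    ((measurable_path hZ).prodMk (measurable_path hε)))).1 h1] with ω hω
  by_contra hc
  simp [Set.indicator, hc] at hω

end Conditional

/-- The standing assumptions on the random maps: independent identically distributed innovations,
independent of the covariates, and a contraction in `L^p` whose coefficient `K` depends on the
covariate. -/
structure IsContractiveModel {Ω E E₁ E₂ : Type*} {_ : MeasurableSpace Ω} [MetricSpace E]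
    [MeasurableSpace E] [MeasurableSpace E₁] [MeasurableSpace E₂] (μ : Measure Ω)
    (F : E → E₁ → E₂ → E) (Z : ℤ → Ω → E₁) (ε : ℤ → Ω → E₂) (p : ℝ) (K : E₁ → ℝ≥0∞) : Prop where
  measurable_map : Measurable fun q : E × E₁ × E₂ => F q.1 q.2.1 q.2.2
  measurable_cov : ∀ t, Measurable (Z t)
  measurable_innov : ∀ t, Measurable (ε t)
  iIndepFun_innov : iIndepFun ε μ
  identDistrib_innov : ∀ t, IdentDistrib (ε t) (ε 0) μ μ
  indepFun_cov_innov : IndepFun (path Z) (path ε) μ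
  one_le : 1 ≤ p
  measurable_coeff : Measurable K
  coeff_ne_top : ∀ z, K z ≠ ∞
  contraction : ∀ z x y,
    ∫⁻ ω, edist (F x z (ε 0 ω)) (F y z (ε 0 ω)) ^ p ∂μ ≤ K z ^ p * edist x y ^ p

/-- The product of the contraction coefficients over the `s + 1` steps that end at time `t`. -/
noncomputable def coeffProd {E₁ : Type*} (K : E₁ → ℝ≥0∞) (z : ℤ → E₁) (t : ℤ) (s : ℕ) : ℝ≥0∞ :=
  ∏ j ∈ Finset.range (s + 1), K (z (t - 1 - j))

/-- The `L^p` size of one step from `x₀`. -/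
noncomputable def stepNorm {Ω E E₁ E₂ : Type*} {_ : MeasurableSpace Ω} [PseudoEMetricSpace E]
    (μ : Measure Ω) (F : E → E₁ → E₂ → E) (ε : ℤ → Ω → E₂) (p : ℝ) (x₀ : E) (z : E₁) : ℝ≥0∞ :=
  lpMean μ p fun ω => edist x₀ (F x₀ z (ε 1 ω))

/-- The covariate sequences along which the backward iterations converge. -/
def IsSummablePath {Ω E E₁ E₂ : Type*} {_ : MeasurableSpace Ω} [PseudoEMetricSpace E]
    (μ : Measure Ω) (F : E → E₁ → E₂ → E) (ε : ℤ → Ω → E₂) (p : ℝ) (K : E₁ → ℝ≥0∞) (x₀ : E)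
    (z : ℤ → E₁) (t : ℤ) : Prop :=
  ∑' s, coeffProd K z t s ≠ ∞ ∧
    ∑' s : ℕ, coeffProd K z t s * stepNorm μ F ε p x₀ (z (t - s - 2)) ≠ ∞

/-! ### Quenched estimates: the covariate path is a fixed sequence. -/

namespace IsContractiveModel

variable {Ω E E₁ E₂ : Type*} {mΩ : MeasurableSpace Ω} {μ : Measure Ω} [IsProbabilityMeasure μ]
  [MetricSpace E] [SecondCountableTopology E]
  [MeasurableSpace E] [BorelSpace E] [MeasurableSpace E₁] [MeasurableSpace E₂]
  {F : E → E₁ → E₂ → E} {Z : ℤ → Ω → E₁} {ε : ℤ → Ω → E₂} {p : ℝ} {K : E₁ → ℝ≥0∞}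

/-- A deterministic path is independent of everything, so the general estimates apply to it; the
product of coefficients is then a constant and leaves the integral. -/
lemma quenched (h : IsContractiveModel μ F Z ε p K) (z : ℤ → E₁) :
    IsContractiveModel μ F (fun t _ => z t) ε p K :=
  { h with
    measurable_cov := fun _ => measurable_const
    indepFun_cov_innov := indepFun_const_left z _ }

lemma identDistrib_step (h : IsContractiveModel μ F Z ε p K) (s t : ℤ) (x : E) (z : E₁) :
    IdentDistrib (fun ω => F x z (ε s ω)) (fun ω => F x z (ε t ω)) μ μ := by
  have : Measurable fun e => F x z e :=
    h.measurable_map.comp (g := fun q : E × E₁ × E₂ => F q.1 q.2.1 q.2.2)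
      (f := fun e => (x, z, e)) (by fun_prop)
  exact ((h.identDistrib_innov s).trans (h.identDistrib_innov t).symm).comp this

lemma contraction_at (h : IsContractiveModel μ F Z ε p K) (t : ℤ) (z : E₁) (x y : E) :
    ∫⁻ ω, edist (F x z (ε t ω)) (F y z (ε t ω)) ^ p ∂μ ≤ K z ^ p * edist x y ^ p := by
  refine le_trans (le_of_eq ?_) (h.contraction z x y)
  have : Measurable fun e => edist (F x z e) (F y z e) ^ p :=
    measurable_edist_step h.measurable_map measurable_id z x y
  exact ((h.identDistrib_innov t).comp this).lintegral_eq

lemma lintegral_backIter_le (h : IsContractiveModel μ F Z ε p K)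
    (s : ℕ) (t : ℤ) {w : Ω → ℝ≥0∞} {U V : Ω → E} (hw : Measurable[fullSigma Z] w)
    (hU : Measurable[jointSigma Z ε (t - s - 1)] U)
    (hV : Measurable[jointSigma Z ε (t - s - 1)] V) :
    ∫⁻ ω, w ω * edist (backIter F Z ε (U ω) s t ω) (backIter F Z ε (V ω) s t ω) ^ p ∂μ
      ≤ ∫⁻ ω, w ω * coeffProd K (path Z ω) t s ^ p * edist (U ω) (V ω) ^ p ∂μ := by
  have hp : 0 ≤ p := by linarith [h.one_le]
  simp only [coeffProd, path, ← ENNReal.prod_rpow_of_nonneg hp]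
  exact lintegral_edist_backIter_le h.measurable_map h.measurable_cov h.measurable_innov
    h.iIndepFun_innov h.indepFun_cov_innov h.measurable_coeff h.contraction_at s t hw hU hV

lemma lpMean_backIter_le (h : IsContractiveModel μ F Z ε p K) (z : ℤ → E₁)
    (s : ℕ) (t : ℤ) {U V : Ω → E} (hU : Measurable[jointSigma (fun t _ => z t) ε (t - s - 1)] U)
    (hV : Measurable[jointSigma (fun t _ => z t) ε (t - s - 1)] V) :
    lpMean μ p (fun ω => edist (backIter F (fun t _ => z t) ε (U ω) s t ω)
        (backIter F (fun t _ => z t) ε (V ω) s t ω))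
      ≤ coeffProd K z t s * lpMean μ p fun ω => edist (U ω) (V ω) := by
  have hp := h.one_le
  refine lpMean_le_of_lintegral_le hp ?_
  have h1 := (h.quenched z).lintegral_backIter_le s t (w := 1) measurable_const hU hV
  simp only [Pi.one_apply, one_mul] at h1
  refine h1.trans (le_of_eq ?_)
  rw [ENNReal.mul_rpow_of_nonneg _ _ (by linarith), lpMean_rpow hp]
  have hle : jointSigma (fun t _ => z t) ε (t - s - 1) ≤ mΩ :=
    sup_le (fullSigma_le fun _ => measurable_const) (pastSigma_le h.measurable_innov _)
  exact lintegral_const_mul (coeffProd K z t s ^ p) (((hU.mono hle le_rfl).edist (hV.mono hle le_rfl)).pow_const p)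

lemma measurable_backIter_const (h : IsContractiveModel μ F Z ε p K) (x : E) (s : ℕ) (t : ℤ) :
    Measurable (backIter F Z ε x s t) :=
  measurable_backIter h.measurable_map measurable_const s (fun j _ => h.measurable_cov j)
    (fun j _ => h.measurable_innov j)

lemma lpMean_const (hp : 1 ≤ p) (a : ℝ≥0∞) : lpMean μ p (fun _ => a) = a := by
  rw [lpMean, lintegral_const, measure_univ, mul_one, ← ENNReal.rpow_mul,
    mul_one_div_cancel (by linarith), ENNReal.rpow_one]

lemma lpMean_backIter_const_le (h : IsContractiveModel μ F Z ε p K) (z : ℤ → E₁) (x y : E)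
    (s : ℕ) (t : ℤ) :
    lpMean μ p (fun ω => edist (backIter F (fun t _ => z t) ε x s t ω)
        (backIter F (fun t _ => z t) ε y s t ω)) ≤ coeffProd K z t s * edist x y := by
  refine (h.lpMean_backIter_le z s t (U := fun _ => x) (V := fun _ => y) measurable_const
    measurable_const).trans (le_of_eq ?_)
  rw [lpMean_const h.one_le]

lemma lpMean_step (h : IsContractiveModel μ F Z ε p K) (x₀ : E) (t : ℤ) (z : E₁) :
    lpMean μ p (fun ω => edist x₀ (F x₀ z (ε t ω))) = stepNorm μ F ε p x₀ z := by
  have : Measurable fun y : E => edist x₀ y ^ p := by fun_prop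
  rw [stepNorm, lpMean, lpMean]
  congr 1
  exact ((h.identDistrib_step t 1 x₀ z).comp this).lintegral_eq

lemma lpMean_backIter_succ_le (h : IsContractiveModel μ F Z ε p K) (z : ℤ → E₁) (x₀ : E)
    (s : ℕ) (t : ℤ) :
    lpMean μ p (fun ω => edist (backIter F (fun t _ => z t) ε x₀ s t ω)
        (backIter F (fun t _ => z t) ε x₀ (s + 1) t ω))
      ≤ coeffProd K z t s * stepNorm μ F ε p x₀ (z (t - s - 2)) := by
  simp only [backIter_succ_eq]
  refine (h.lpMean_backIter_le z s t (U := fun _ => x₀)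
    (V := fun ω => rmap F (fun t _ => z t) ε (t - s - 1) ω x₀) measurable_const ?_).trans (le_of_eq ?_)
  · exact measurable_backIter (Z := fun t _ => z t) h.measurable_map measurable_const 0
      (fun j _ => measurable_const)
      (fun j hj => (measurable_pastSigma ε hj).mono le_sup_right le_rfl)
  · simp only [rmap]
    rw [h.lpMean_step, show t - (s : ℤ) - 1 - 1 = t - s - 2 by ring]

variable [CompleteSpace E] {x₀ : E} {z : ℤ → E₁} {t : ℤ}

lemma measurable_limIter (h : IsContractiveModel μ F Z ε p K) (x : E) (t : ℤ) :
    Measurable (limIter F Z ε x t) :=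
  ExoMaps.measurable_limIter h.measurable_map _ (fun j _ => h.measurable_cov j)
    (fun j _ => h.measurable_innov j)

lemma ae_tendsto_limIter_self (h : IsContractiveModel μ F Z ε p K)
    (hz : IsSummablePath μ F ε p K x₀ z t) :
    ∀ᵐ ω ∂μ, Tendsto (fun s => backIter F (fun t _ => z t) ε x₀ s t ω) atTop
      (𝓝 (limIter F (fun t _ => z t) ε x₀ t ω)) :=
  (ae_exists_tendsto_of_tsum_lpMean h.one_le
    (fun s => (h.quenched z).measurable_backIter_const x₀ s t)
    (fun s => h.lpMean_backIter_succ_le z x₀ s t) hz.2).mono fun _ hω => tendsto_limIter hω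

lemma lpMean_limIter_self_le (h : IsContractiveModel μ F Z ε p K)
    (hz : IsSummablePath μ F ε p K x₀ z t) (s : ℕ) :
    lpMean μ p (fun ω => edist (backIter F (fun t _ => z t) ε x₀ s t ω)
      (limIter F (fun t _ => z t) ε x₀ t ω)) ≤
      ∑' k : ℕ, coeffProd K z t (k + s) * stepNorm μ F ε p x₀ (z (t - (k + s : ℕ) - 2)) :=
  lpMean_edist_le_tsum h.one_le (fun s => (h.quenched z).measurable_backIter_const x₀ s t)
    (fun s => h.lpMean_backIter_succ_le z x₀ s t) (h.ae_tendsto_limIter_self hz) s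

/-- The limit is always the one started from `x₀`: the iterates from `x` and from `x₀` differ by at
most a vanishing product times `edist x x₀`. -/
lemma tendsto_lpMean_limIter (h : IsContractiveModel μ F Z ε p K)
    (hz : IsSummablePath μ F ε p K x₀ z t) (x : E) :
    Tendsto (fun s => lpMean μ p fun ω => edist (backIter F (fun t _ => z t) ε x s t ω)
      (limIter F (fun t _ => z t) ε x₀ t ω)) atTop (𝓝 0) := by
  have h1 := ENNReal.tendsto_sum_nat_add _ hz.2
  have h2 : Tendsto (fun s => coeffProd K z t s * edist x x₀) atTop (𝓝 0) := by
    simpa using ENNReal.Tendsto.mul_const (ENNReal.tendsto_atTop_zero_of_tsum_ne_top hz.1)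
      (Or.inr (edist_ne_top x x₀))
  refine tendsto_of_tendsto_of_tendsto_of_le_of_le tendsto_const_nhds
    (by simpa using h2.add h1) (fun _ => zero_le) fun s => ?_
  have hm := (h.quenched z).measurable_backIter_const
  exact (lpMean_edist_triangle h.one_le (hm x s t) (hm x₀ s t)
    ((h.quenched z).measurable_limIter x₀ t)).trans
    (add_le_add (h.lpMean_backIter_const_le z x x₀ s t) (h.lpMean_limIter_self_le hz s))

lemma ae_tendsto_limIter (h : IsContractiveModel μ F Z ε p K)
    (hz : IsSummablePath μ F ε p K x₀ z t) (x : E) :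
    ∀ᵐ ω ∂μ, Tendsto (fun s => backIter F (fun t _ => z t) ε x s t ω) atTop
      (𝓝 (limIter F (fun t _ => z t) ε x₀ t ω)) := by
  have hm := (h.quenched z).measurable_backIter_const
  have h1 := ae_tendsto_edist_zero_of_tsum_lpMean h.one_le (fun s => hm x s t)
    (fun s => hm x₀ s t) (fun s => h.lpMean_backIter_const_le z x x₀ s t)
    (by rw [ENNReal.tsum_mul_right]; exact ENNReal.mul_ne_top hz.1 (edist_ne_top x x₀))
  filter_upwards [h1, h.ae_tendsto_limIter_self hz] with ω h2 h3
  rw [tendsto_iff_edist_tendsto_0] at h3 ⊢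
  exact tendsto_of_tendsto_of_tendsto_of_le_of_le tendsto_const_nhds
    (by simpa using h2.add h3) (fun _ => zero_le) fun s => edist_triangle _ _ _

lemma lintegral_limIter_lt_top (h : IsContractiveModel μ F Z ε p K)
    (hz : IsSummablePath μ F ε p K x₀ z t)
    (hmom : ∀ z, ∫⁻ ω, edist (F x₀ z (ε 1 ω)) x₀ ^ p ∂μ < ∞) :
    ∫⁻ ω, edist (limIter F (fun t _ => z t) ε x₀ t ω) x₀ ^ p ∂μ < ∞ := by
  have hp := h.one_le
  rw [← lpMean_rpow hp]
  refine ENNReal.rpow_lt_top_of_nonneg (by linarith) (ne_top_of_le_ne_top ?_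
    (lpMean_edist_triangle hp ((h.quenched z).measurable_limIter x₀ t)
      ((h.quenched z).measurable_backIter_const x₀ 0 t) measurable_const))
  refine ENNReal.add_ne_top.2 ⟨?_, ?_⟩
  · simp only [edist_comm (limIter _ _ _ _ _ _)]
    exact ne_top_of_le_ne_top hz.2 (h.lpMean_limIter_self_le hz 0)
  · simp only [edist_comm _ x₀, backIter, rmap]
    rw [h.lpMean_step, stepNorm, lpMean]
    refine ENNReal.rpow_ne_top_of_nonneg (by positivity) ?_
    simpa only [edist_comm x₀] using (hmom (z (t - 1))).ne

/-- The map `F` need not be continuous in its first argument, so the recursion is passed to the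
limit in `L^p`, where the contraction of the single map at time `t` replaces continuity. -/
lemma ae_limIter_eq_rmap (h : IsContractiveModel μ F Z ε p K)
    (hz : IsSummablePath μ F ε p K x₀ z t) (hz' : IsSummablePath μ F ε p K x₀ z (t - 1)) :
    ∀ᵐ ω ∂μ, limIter F (fun t _ => z t) ε x₀ t ω
      = rmap F (fun t _ => z t) ε t ω (limIter F (fun t _ => z t) ε x₀ (t - 1) ω) := by
  have hp := h.one_le
  have hm := (h.quenched z).measurable_backIter_const x₀
  have hL := (h.quenched z).measurable_limIter x₀
  have hr : Measurable fun ω =>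
      rmap F (fun t _ => z t) ε t ω (limIter F (fun t _ => z t) ε x₀ (t - 1) ω) :=
    h.measurable_map.comp ((hL _).prodMk (measurable_const.prodMk (h.measurable_innov t)))
  have h0 : Measurable[jointSigma (fun t _ => z t) ε (t - (0 : ℕ) - 1)]
      (limIter F (fun t _ => z t) ε x₀ (t - 1)) := by
    rw [Nat.cast_zero, sub_zero]
    exact ExoMaps.measurable_limIter h.measurable_map _ (fun j _ => measurable_const)
      (fun j hj => (measurable_pastSigma ε hj).mono le_sup_right le_rfl)
  have h0' (s : ℕ) : Measurable[jointSigma (fun t _ => z t) ε (t - (0 : ℕ) - 1)]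
      (backIter F (fun t _ => z t) ε x₀ s (t - 1)) := by
    rw [Nat.cast_zero, sub_zero]
    exact measurable_backIter h.measurable_map measurable_const _ (fun j _ => measurable_const)
      (fun j hj => (measurable_pastSigma ε hj).mono le_sup_right le_rfl)
  refine ae_eq_of_lpMean_edist_eq_zero hp (hL t) hr (le_antisymm ?_ zero_le)
  have h1 := (tendsto_add_atTop_iff_nat 1).2 (h.tendsto_lpMean_limIter hz x₀)
  have h2 : Tendsto (fun s => coeffProd K z t 0 * lpMean μ p fun ω =>
      edist (backIter F (fun t _ => z t) ε x₀ s (t - 1) ω)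
        (limIter F (fun t _ => z t) ε x₀ (t - 1) ω)) atTop (𝓝 0) := by
    simpa using ENNReal.Tendsto.const_mul (a := coeffProd K z t 0)
      (h.tendsto_lpMean_limIter hz' x₀)
      (Or.inr (by simp [coeffProd, h.coeff_ne_top]))
  refine ge_of_tendsto (by simpa using h1.add h2) (Eventually.of_forall fun s => ?_)
  refine (lpMean_edist_triangle hp (hL t) (hm (s + 1) t) hr).trans (add_le_add ?_ ?_)
  · exact le_of_eq (by simp only [edist_comm])
  · exact h.lpMean_backIter_le z 0 t (h0' s) h0

end IsContractiveModel

/-! ### Two consequences of measure preservation and ergodicity: bounded Birkhoff sums and sublinear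
growth. -/

section Ergodic

variable {α : Type*}

/-- The maximum of the Birkhoff sums of length at most `n`, the empty one included. -/
noncomputable def maxBirkhoffSum (T : α → α) (g : α → ℝ) : ℕ → α → ℝ
  | 0, _ => 0
  | n + 1, x => max 0 (g x + maxBirkhoffSum T g n (T x))

lemma maxBirkhoffSum_nonneg (T : α → α) (g : α → ℝ) (n : ℕ) (x : α) :
    0 ≤ maxBirkhoffSum T g n x := by
  cases n <;> simp [maxBirkhoffSum]

lemma maxBirkhoffSum_le_succ (T : α → α) (g : α → ℝ) (n : ℕ) (x : α) :
    maxBirkhoffSum T g n x ≤ maxBirkhoffSum T g (n + 1) x := by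
  induction n generalizing x with
  | zero => exact maxBirkhoffSum_nonneg T g 1 x
  | succ n ih => exact max_le_max le_rfl (by simpa using ih (T x))

lemma birkhoffSum_le_maxBirkhoffSum (T : α → α) (g : α → ℝ) (n : ℕ) (x : α) :
    birkhoffSum T g n x ≤ maxBirkhoffSum T g n x := by
  induction n generalizing x with
  | zero => simp [maxBirkhoffSum]
  | succ n ih =>
    rw [birkhoffSum_succ']
    exact le_max_of_le_right (by simpa using ih (T x))

variable [MeasurableSpace α] {P : Measure α} {T : α → α} {g : α → ℝ}

lemma measurable_birkhoffSum (hT : Measurable T) (hg : Measurable g) (n : ℕ) :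
    Measurable (birkhoffSum T g n) := by
  unfold birkhoffSum
  exact Finset.measurable_fun_sum _ fun k _ => hg.comp (hT.iterate k)

lemma integrable_maxBirkhoffSum (hT : MeasurePreserving T P P) (hgi : Integrable g P) (n : ℕ) :
    Integrable (maxBirkhoffSum T g n) P := by
  induction n with
  | zero => exact integrable_zero _ _ _
  | succ n ih => exact (integrable_zero _ _ _).sup (hgi.add (hT.integrable_comp_of_integrable ih))

/-- For an ergodic transformation, the Birkhoff sums of a function with a negative integral are
almost surely bounded above. -/
lemma ae_bddAbove_birkhoffSum (hT : Ergodic T P) (hg : Measurable g) (hgi : Integrable g P)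
    (hneg : ∫ x, g x ∂P < 0) : ∀ᵐ x ∂P, ∃ C : ℝ, ∀ n, birkhoffSum T g n x ≤ C := by
  let B : Set α := {x | ∃ C : ℕ, ∀ n, birkhoffSum T g n x ≤ C}
  have hB : MeasurableSet B := by
    simp only [B, Set.ofPred_exists, Set.ofPred_forall]
    exact MeasurableSet.iUnion fun C => MeasurableSet.iInter fun n =>
      measurableSet_le (measurable_birkhoffSum hT.measurable hg n) measurable_const
  have hinv : T ⁻¹' B = B := by
    ext x
    constructor
    · rintro ⟨C, hC⟩
      obtain ⟨D, hD⟩ := exists_nat_ge (max 0 (g x + C))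
      refine ⟨D, fun n => le_trans ?_ hD⟩
      cases n with
      | zero => simp
      | succ n =>
        rw [birkhoffSum_succ']
        exact le_max_of_le_right (by simpa using hC n)
    · rintro ⟨C, hC⟩
      obtain ⟨D, hD⟩ := exists_nat_ge (C - g x)
      refine ⟨D, fun n => le_trans ?_ hD⟩
      have := hC (n + 1)
      rw [birkhoffSum_succ'] at this
      linarith
  rcases hT.toPreErgodic.ae_mem_or_ae_notMem hB hinv with h | h
  · exact h.mono fun x ⟨C, hC⟩ => ⟨C, hC⟩
  exfalso
  have hTp := hT.toMeasurePreserving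
  have hM := integrable_maxBirkhoffSum hTp hgi
  have hMT (n : ℕ) : Integrable (fun x => maxBirkhoffSum T g n (T x)) P :=
    hTp.integrable_comp_of_integrable (hM n)
  -- The difference equals `max (-M_n (T x)) (g x)`, where `M_n` is the maximum of the Birkhoff
  -- sums. It is dominated by `|g|`, and it equals `g x` for large `n` when the sums at `T x` are
  -- unbounded. Its integral is nonnegative by invariance and monotonicity of `M_n`, against `∫ g <
  -- 0`.
  have hlim : Tendsto (fun n => ∫ x, (maxBirkhoffSum T g (n + 1) x
      - maxBirkhoffSum T g n (T x)) ∂P) atTop (𝓝 (∫ x, g x ∂P)) := by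
    refine tendsto_integral_of_dominated_convergence (fun x => |g x|)
      (fun n => ((hM _).sub (hMT n)).aestronglyMeasurable) hgi.abs (fun n => ?_) ?_
    · refine ae_of_all _ fun x => ?_
      have h0 := maxBirkhoffSum_nonneg T g n (T x)
      rw [maxBirkhoffSum, Real.norm_eq_abs, abs_le]
      have h1 := le_max_right 0 (g x + maxBirkhoffSum T g n (T x))
      refine ⟨by linarith [neg_abs_le (g x)], ?_⟩
      rw [sub_le_iff_le_add]
      exact max_le (by positivity) (by linarith [le_abs_self (g x)])
    · filter_upwards [h] with x hx
      have hx' : T x ∉ B := fun h' => hx (hinv ▸ h')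
      simp only [B, Set.mem_ofPred_eq, not_exists, not_forall, not_le] at hx'
      obtain ⟨C, hC⟩ := exists_nat_ge (-g x)
      obtain ⟨N, hN⟩ := hx' C
      refine tendsto_const_nhds.congr' ?_
      filter_upwards [eventually_ge_atTop N] with n hn
      have h1 : (C : ℝ) < maxBirkhoffSum T g n (T x) :=
        (hN.trans_le (birkhoffSum_le_maxBirkhoffSum T g N (T x))).trans_le
          (monotone_nat_of_le_succ (f := fun n => maxBirkhoffSum T g n (T x))
            (fun n => maxBirkhoffSum_le_succ T g n (T x)) hn)
      rw [maxBirkhoffSum, max_eq_right (by linarith)]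
      ring
  refine hneg.not_ge (ge_of_tendsto' hlim fun n => ?_)
  rw [integral_sub (hM _) (hMT n), sub_nonneg]
  have : ∫ x, maxBirkhoffSum T g n (T x) ∂P = ∫ x, maxBirkhoffSum T g n x ∂P := by
    have h1 := integral_map (μ := P) hTp.measurable.aemeasurable
      (f := maxBirkhoffSum T g n) (by rw [hTp.map_eq]; exact (hM n).aestronglyMeasurable)
    rw [hTp.map_eq] at h1
    exact h1.symm
  rw [this]
  exact integral_mono (hM _) (hM _) fun x => maxBirkhoffSum_le_succ T g n x

/-- Borel–Cantelli: the events have the probabilities `P (g / δ > n)`, summable because `g` is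
integrable. -/
lemma ae_eventually_comp_iterate_le [IsProbabilityMeasure P] (hT : MeasurePreserving T P P)
    (hg : Measurable g) (hgi : Integrable g P) (hg0 : 0 ≤ g) {δ : ℝ} (hδ : 0 < δ) :
    ∀ᵐ x ∂P, ∀ᶠ n : ℕ in atTop, g (T^[n] x) ≤ δ * n := by
  let _ : MeasureSpace α := ⟨P⟩
  have hP : IsProbabilityMeasure (volume : Measure α) := ‹IsProbabilityMeasure P›
  have h1 := tsum_prob_mem_Ioi_lt_top (X := fun x => g x / δ) (hgi.div_const δ)
    (fun x => div_nonneg (hg0 x) hδ.le)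
  have h2 (n : ℕ) : P {x | g (T^[n] x) / δ ∈ Set.Ioi (n : ℝ)}
      = P {x | g x / δ ∈ Set.Ioi (n : ℝ)} :=
    (hT.iterate n).measure_preimage
      (measurableSet_Ioi.preimage (hg.div_const δ)).nullMeasurableSet
  have h3 : ∑' n : ℕ, P {x | g (T^[n] x) / δ ∈ Set.Ioi (n : ℝ)} ≠ ∞ := by
    simp only [h2]
    exact h1.ne
  filter_upwards [ae_eventually_notMem h3] with x hx
  filter_upwards [hx] with n hn
  simp only [Set.mem_Ioi, not_lt] at hn
  rwa [div_le_iff₀' hδ] at hn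

end Ergodic

/-! ### The shift and its inverse, whose iterates read the past. -/

section Shift

variable {S : Type*} [MeasurableSpace S]

/-- The shift as a measurable equivalence. -/
def shiftEquiv (S : Type*) [MeasurableSpace S] : (ℤ → S) ≃ᵐ (ℤ → S) where
  toFun := shift
  invFun u t := u (t - 1)
  left_inv u := by ext; simp [shift]
  right_inv u := by ext; simp [shift]
  measurable_toFun := measurable_pi_lambda _ fun _ => measurable_pi_apply _
  measurable_invFun := measurable_pi_lambda _ fun _ => measurable_pi_apply _

lemma measurable_shift : Measurable (shift : (ℤ → S) → ℤ → S) := (shiftEquiv S).measurable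

lemma shiftEquiv_symm_iterate (n : ℕ) (u : ℤ → S) (t : ℤ) :
    ((shiftEquiv S).symm)^[n] u t = u (t - n) := by
  induction n generalizing u with
  | zero => simp
  | succ n ih =>
    rw [Function.iterate_succ_apply, ih]
    change u (t - n - 1) = _
    congr 1; push_cast; ring

end Shift

lemma tsum_ne_top_of_eventually_le {a b : ℕ → ℝ≥0∞} (ha : ∀ n, a n ≠ ∞)
    (hab : ∀ᶠ n in atTop, a n ≤ b n) (hb : ∑' n, b n ≠ ∞) : ∑' n, a n ≠ ∞ := by
  obtain ⟨N, hN⟩ := eventually_atTop.1 hab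
  have h1 : ∑ n ∈ Finset.range N, a n ≠ ∞ := ENNReal.sum_ne_top.2 fun n _ => ha n
  have h2 : ∑' n, a (n + N) ≤ ∑' n, b (n + N) :=
    ENNReal.tsum_le_tsum fun n => hN _ (Nat.le_add_left N n)
  have h3 : ∑' n, b (n + N) ≤ ∑' n, b n :=
    ENNReal.tsum_comp_le_tsum_of_injective (f := fun n => n + N) (add_left_injective N) b
  have h4 : ∑' n, a n ≤ ∑ n ∈ Finset.range N, a n + ∑' n, a (n + N) := by
    rw [(ENNReal.summable (f := fun n => a (n + N))).sum_add_tsum_nat_add']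
  exact ne_top_of_le_ne_top
    (ENNReal.add_ne_top.2 ⟨h1, ne_top_of_le_ne_top hb (h2.trans h3)⟩) h4

lemma tsum_ofReal_exp_ne_top (C : ℝ) {δ : ℝ} (hδ : 0 < δ) :
    ∑' n : ℕ, ENNReal.ofReal (Real.exp (C - δ * (n + 1 : ℕ))) ≠ ∞ := by
  have h1 : Summable fun n : ℕ => Real.exp (C - δ * (n + 1 : ℕ)) := by
    have h2 : Summable fun n : ℕ => Real.exp (C - δ) * Real.exp (-δ) ^ n :=
      (summable_geometric_of_lt_one (Real.exp_pos _).le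
        (Real.exp_lt_one_iff.2 (by linarith))).mul_left _
    refine h2.congr fun n => ?_
    rw [← Real.exp_nat_mul, ← Real.exp_add]
    congr 1; push_cast; ring
  exact h1.tsum_ofReal_ne_top

lemma le_exp_posLog {x : ℝ} (hx : 0 ≤ x) : x ≤ Real.exp (Real.posLog x) := by
  rcases hx.eq_or_lt with rfl | hx
  · positivity
  · exact (Real.exp_log hx).symm.le.trans (Real.exp_le_exp.2 (le_max_right _ _))

/-! ### Truncation of a function with negative, possibly infinite, mean. -/

section Negative

variable {Ω : Type*} {mΩ : MeasurableSpace Ω} {μ : Measure Ω}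

/-- A function with a negative extended mean has an integrable majorant, truncated from below and
shifted up by a positive constant, whose mean is still negative. -/
lemma exists_integral_max_add_neg [IsProbabilityMeasure μ] {f : Ω → ℝ} (hf : Measurable f)
    (hpos : Integrable (fun ω => max 0 (f ω)) μ) (hneg : extMean μ f < 0) :
    ∃ M δ : ℝ, 0 < δ ∧ Integrable (fun ω => max (f ω) (-M) + δ) μ ∧
      ∫ ω, (max (f ω) (-M) + δ) ∂μ < 0 := by
  set A := ∫⁻ ω, ENNReal.ofReal (f ω) ∂μ
  have hAtop : A ≠ ∞ := by
    have := hpos.lintegral_lt_top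
    simpa [A, ENNReal.ofReal_max] using this.ne
  have h1 : A < ∫⁻ ω, ENNReal.ofReal (-f ω) ∂μ := by
    by_contra hc
    push Not at hc
    have : (0 : EReal) ≤ extMean μ f := by
      rw [extMean, EReal.sub_nonneg (Or.inl (by simpa using hAtop))
        (Or.inl (EReal.coe_ennreal_ne_bot _))]
      exact_mod_cast hc
    exact hneg.not_ge this
  -- By monotone convergence the negative part cut at some level `n` already outweighs the positive
  -- part, also when the mean is `-∞`.
  have h2 : Tendsto (fun n : ℕ => ∫⁻ ω, ENNReal.ofReal (min (-f ω) n) ∂μ) atTop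
      (𝓝 (∫⁻ ω, ENNReal.ofReal (-f ω) ∂μ)) := by
    refine lintegral_tendsto_of_tendsto_of_monotone
      (fun n => ((hf.neg.min measurable_const).ennreal_ofReal).aemeasurable) ?_ ?_
    · exact ae_of_all _ fun ω m n hmn => ENNReal.ofReal_le_ofReal
        (min_le_min le_rfl (by exact_mod_cast hmn))
    · refine ae_of_all _ fun ω => tendsto_const_nhds.congr' ?_
      obtain ⟨N, hN⟩ := exists_nat_ge (-f ω)
      filter_upwards [eventually_ge_atTop N] with n hn
      rw [min_eq_left (hN.trans (by exact_mod_cast hn))]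
  obtain ⟨n, hn⟩ := (h2.eventually (lt_mem_nhds h1)).exists
  have hint : Integrable (fun ω => max (f ω) (-(n : ℝ))) μ := by
    refine (hpos.add (integrable_const (n : ℝ))).mono'
      (hf.max measurable_const).aestronglyMeasurable (ae_of_all _ fun ω => ?_)
    have hn0 : (0 : ℝ) ≤ n := n.cast_nonneg
    have h3 := le_max_left 0 (f ω)
    have h4 := le_max_right 0 (f ω)
    rw [Real.norm_eq_abs, abs_le, Pi.add_apply]
    exact ⟨by linarith [le_max_right (f ω) (-(n : ℝ))], max_le (by linarith) (by linarith)⟩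
  have hI : ∫ ω, max (f ω) (-(n : ℝ)) ∂μ < 0 := by
    rw [integral_eq_lintegral_pos_part_sub_lintegral_neg_part hint, sub_neg]
    have e1 : ∫⁻ ω, ENNReal.ofReal (max (f ω) (-(n : ℝ))) ∂μ = A := by
      refine lintegral_congr fun ω => ?_
      rw [ENNReal.ofReal_max, ENNReal.ofReal_of_nonpos (p := -(n : ℝ)) (by simp)]
      simp
    have e2 : ∫⁻ ω, ENNReal.ofReal (-max (f ω) (-(n : ℝ))) ∂μ
        = ∫⁻ ω, ENNReal.ofReal (min (-f ω) n) ∂μ := by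
      refine lintegral_congr fun ω => ?_
      rw [← min_neg_neg, neg_neg]
    rw [e1, e2]
    refine (ENNReal.toReal_lt_toReal hAtop ?_).2 hn
    refine ne_top_of_le_ne_top (ENNReal.natCast_ne_top n) ?_
    calc ∫⁻ ω, ENNReal.ofReal (min (-f ω) n) ∂μ ≤ ∫⁻ _, (n : ℝ≥0∞) ∂μ := by
          refine lintegral_mono fun ω => ?_
          rw [← ENNReal.ofReal_natCast]
          exact ENNReal.ofReal_le_ofReal (min_le_right _ _)
      _ = n := by simp
  set I := ∫ ω, max (f ω) (-(n : ℝ)) ∂μ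
  -- Half of the negative mean is spent on `δ`, and the other half keeps the new mean equal to `I /
  -- 2 < 0`.
  refine ⟨n, -I / 2, by linarith, hint.add (integrable_const _), ?_⟩
  rw [integral_add hint (integrable_const _)]
  simp only [integral_const, probReal_univ, one_smul]
  linarith

end Negative

/-! ### Almost every covariate path makes the series converge. -/

section SummablePaths

variable {Ω E E₁ E₂ : Type*} {mΩ : MeasurableSpace Ω} {μ : Measure Ω} [IsProbabilityMeasure μ]
  [MetricSpace E] [SecondCountableTopology E]
  [MeasurableSpace E] [BorelSpace E] [MeasurableSpace E₁] [MeasurableSpace E₂]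
  {F : E → E₁ → E₂ → E} {Z : ℤ → Ω → E₁} {ε : ℤ → Ω → E₂} {p : ℝ} {κ : E₁ → ℝ} {x₀ : E}

/-- The constant `δ` added to each logarithm becomes an exponential rate: sums bounded by `C` with
it are at most `C - δ n` without it. -/
lemma prod_ofReal_le_exp (hκ : ∀ z, 0 < κ z) {M δ C : ℝ} (v : ℕ → E₁)
    (hC : ∀ n, ∑ k ∈ Finset.range n, (max (Real.log (κ (v k))) (-M) + δ) ≤ C) (n : ℕ) :
    ∏ k ∈ Finset.range n, ENNReal.ofReal (κ (v k)) ≤ ENNReal.ofReal (Real.exp (C - δ * n)) := by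
  rw [← ENNReal.ofReal_prod_of_nonneg fun k _ => (hκ _).le]
  refine ENNReal.ofReal_le_ofReal ?_
  have h1 : ∏ k ∈ Finset.range n, κ (v k)
      = Real.exp (∑ k ∈ Finset.range n, Real.log (κ (v k))) := by
    rw [Real.exp_sum]
    exact Finset.prod_congr rfl fun k _ => (Real.exp_log (hκ _)).symm
  rw [h1, Real.exp_le_exp]
  have h2 : ∑ k ∈ Finset.range n, Real.log (κ (v k))
      ≤ ∑ k ∈ Finset.range n, max (Real.log (κ (v k))) (-M) :=
    Finset.sum_le_sum fun k _ => le_max_left _ _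
  have h3 := hC n
  rw [Finset.sum_add_distrib] at h3
  simp only [Finset.sum_const, Finset.card_range, nsmul_eq_mul] at h3
  linarith

/-- An exponential decay of the products of coefficients, together with a subexponential growth of
the sizes of one step, makes the series of a covariate sequence converge. -/
lemma isSummablePath_of_bounds (hp : 1 ≤ p) (hκ : ∀ z, 0 < κ z)
    (hmom : ∀ z, ∫⁻ ω, edist x₀ (F x₀ z (ε 1 ω)) ^ p ∂μ ≠ ∞) {M δ C : ℝ} (hδ : 0 < δ)
    {z : ℤ → E₁} {t : ℤ}
    (hC : ∀ n, ∑ k ∈ Finset.range n, (max (Real.log (κ (z (t - 1 - k)))) (-M) + δ) ≤ C)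
    (hlog : ∀ᶠ n : ℕ in atTop, Real.posLog (∫⁻ ω, edist x₀ (F x₀ (z (t - 1 - n)) (ε 1 ω)) ^ p
      ∂μ).toReal ≤ p * (δ / 2) * n) :
    IsSummablePath μ F ε p (fun z => ENNReal.ofReal (κ z)) x₀ z t := by
  have hprod (s : ℕ) : coeffProd (fun z => ENNReal.ofReal (κ z)) z t s
      ≤ ENNReal.ofReal (Real.exp (C - δ * (s + 1 : ℕ))) :=
    prod_ofReal_le_exp hκ (fun k : ℕ => z (t - 1 - k)) hC (s + 1)
  have hstep (z : E₁) : stepNorm μ F ε p x₀ z ≠ ∞ :=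
    ENNReal.rpow_ne_top_of_nonneg (by positivity) (hmom z)
  have hcoeff (s : ℕ) : coeffProd (fun z => ENNReal.ofReal (κ z)) z t s ≠ ∞ :=
    ne_top_of_le_ne_top ENNReal.ofReal_ne_top (hprod s)
  refine ⟨ne_top_of_le_ne_top (tsum_ofReal_exp_ne_top C hδ) (ENNReal.tsum_le_tsum hprod),
    tsum_ne_top_of_eventually_le (fun s => ENNReal.mul_ne_top (hcoeff s) (hstep _)) ?_
    (tsum_ofReal_exp_ne_top C (half_pos hδ))⟩
  -- The step that follows `s + 1` coefficients uses the covariate at time `t - 1 - (s + 1)`, hence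
  -- the shift by one. The factor `p` in `hlog` disappears with the `p`-th root, so growth at rate
  -- `δ / 2` meets decay at rate `δ`.
  filter_upwards [(tendsto_add_atTop_nat 1).eventually hlog] with s hs
  have e : t - 1 - ((s + 1 : ℕ) : ℤ) = t - s - 2 := by push_cast; ring
  rw [e] at hs
  have h1 : stepNorm μ F ε p x₀ (z (t - s - 2))
      ≤ ENNReal.ofReal (Real.exp (δ / 2 * (s + 1 : ℕ))) := by
    refine lpMean_le_of_lintegral_le hp ?_
    rw [← ENNReal.ofReal_toReal (hmom (z (t - s - 2))),
      ENNReal.ofReal_rpow_of_pos (Real.exp_pos _), ← Real.exp_mul]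
    refine ENNReal.ofReal_le_ofReal ((le_exp_posLog ENNReal.toReal_nonneg).trans ?_)
    refine Real.exp_le_exp.2 (hs.trans (le_of_eq ?_))
    ring
  refine (mul_le_mul' (hprod s) h1).trans (le_of_eq ?_)
  rw [← ENNReal.ofReal_mul (Real.exp_pos _).le, ← Real.exp_add]
  congr 2
  ring

lemma ae_isSummablePath (hF : Measurable fun q : E × E₁ × E₂ => F q.1 q.2.1 q.2.2)
    (hZ : ∀ t, Measurable (Z t)) (hε : ∀ t, Measurable (ε t)) (hp : 1 ≤ p)
    (hZerg : IsStationaryErgodic μ Z) (hκm : Measurable κ) (hκ : ∀ z, 0 < κ z)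
    (hκlog : Integrable (fun ω => Real.posLog (κ (Z 0 ω))) μ)
    (hκneg : extMean μ (fun ω => Real.log (κ (Z 0 ω))) < 0)
    (hmom : ∀ z, ∫⁻ ω, edist x₀ (F x₀ z (ε 1 ω)) ^ p ∂μ ≠ ∞)
    (hlog : Integrable (fun ω => Real.posLog
      (∫⁻ ω', edist x₀ (F x₀ (Z 0 ω) (ε 1 ω')) ^ p ∂μ).toReal) μ) (t : ℤ) :
    ∀ᵐ ω ∂μ, IsSummablePath μ F ε p (fun z => ENNReal.ofReal (κ z)) x₀ (path Z ω) t := by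
  have hZp : Measurable (path Z) := measurable_path hZ
  have hP : IsProbabilityMeasure (μ.map (path Z)) :=
    Measure.isProbabilityMeasure_map hZp.aemeasurable
  have hT : Ergodic (shiftEquiv E₁).symm (μ.map (path Z)) :=
    Ergodic.symm (e := shiftEquiv E₁) hZerg.2
  obtain ⟨M, δ, hδ, hgi, hgneg⟩ := exists_integral_max_add_neg (μ := μ)
    (f := fun ω => Real.log (κ (Z 0 ω))) (Real.measurable_log.comp (hκm.comp (hZ 0))) hκlog hκneg
  let g : (ℤ → E₁) → ℝ := fun u => max (Real.log (κ (u 0))) (-M) + δ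
  have hg : Measurable g :=
    ((Real.measurable_log.comp (hκm.comp (measurable_pi_apply 0))).max
      measurable_const).add_const δ
  have h1 := ae_bddAbove_birkhoffSum hT hg
    ((integrable_map_measure hg.aestronglyMeasurable hZp.aemeasurable).2 hgi)
    (by rw [integral_map hZp.aemeasurable hg.aestronglyMeasurable]; exact hgneg)
  let f : (ℤ → E₁) → ℝ := fun u =>
    Real.posLog (∫⁻ ω', edist x₀ (F x₀ (u 0) (ε 1 ω')) ^ p ∂μ).toReal
  have hf : Measurable f := by
    have hm : Measurable fun q : (ℤ → E₁) × Ω => edist x₀ (F x₀ (q.1 0) (ε 1 q.2)) ^ p := by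
      have : Measurable fun q : (ℤ → E₁) × Ω => F x₀ (q.1 0) (ε 1 q.2) :=
        hF.comp (g := fun q : E × E₁ × E₂ => F q.1 q.2.1 q.2.2)
          (f := fun q : (ℤ → E₁) × Ω => (x₀, q.1 0, ε 1 q.2))
          (measurable_const.prodMk (((measurable_pi_apply 0).comp measurable_fst).prodMk
            ((hε 1).comp measurable_snd)))
      exact (measurable_const.edist this).pow_const p
    exact measurable_const.max (Real.measurable_log.comp hm.lintegral_prod_right'.ennreal_toReal)
  have h2 := ae_eventually_comp_iterate_le hT.toMeasurePreserving hf
    ((integrable_map_measure hf.aestronglyMeasurable hZp.aemeasurable).2 hlog)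
    (fun u => Real.posLog_nonneg) (δ := p * (δ / 2)) (by positivity)
  have h3 := h1.and h2
  -- The Birkhoff sums start at coordinate `0`, whereas the products start at time `t - 1`;
  -- stationarity translates one into the other.
  rw [← hZerg.1 (t - 1)] at h3
  filter_upwards [ae_of_ae_map (measurable_path fun j => hZ (j + (t - 1))).aemeasurable h3]
    with ω ⟨⟨C, hC⟩, hev⟩
  have e (k : ℕ) : ((shiftEquiv E₁).symm)^[k] (path (fun j => Z (j + (t - 1))) ω) 0
      = path Z ω (t - 1 - k) := by
    rw [shiftEquiv_symm_iterate]
    simp only [path]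
    rw [show (0 : ℤ) - k + (t - 1) = t - 1 - k by ring]
  refine isSummablePath_of_bounds hp hκ hmom (M := M) (C := C) hδ ?_ ?_
  · intro n
    simpa only [birkhoffSum, g, e] using hC n
  · simpa only [f, e] using hev

end SummablePaths

/-! ### Joint ergodicity of an ergodic process and an independent i.i.d. process. -/

section JointErgodicity

variable {Ω S R : Type*} {mΩ : MeasurableSpace Ω} {μ : Measure Ω} [IsProbabilityMeasure μ]
  [MeasurableSpace S] [MeasurableSpace R] {Z : ℤ → Ω → S} {ε : ℤ → Ω → R}

lemma isStationary_of_iid (hε : ∀ t, Measurable (ε t)) (hεindep : iIndepFun ε μ)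
    (hεident : ∀ t, IdentDistrib (ε t) (ε 0) μ μ) : IsStationary μ ε := by
  intro h
  have h1 : iIndepFun (fun t => ε (t + h)) μ := hεindep.precomp (add_left_injective h)
  have h2 := hεindep.map_fun_eq_infinitePi_map hε
  have h3 := h1.map_fun_eq_infinitePi_map fun t => hε (t + h)
  have e (t : ℤ) : μ.map (ε t) = μ.map (ε 0) := (hεident t).map_eq
  simp only [e] at h2 h3
  exact h3.trans h2.symm

lemma measurable_shiftBy (h : ℤ) : Measurable fun (u : ℤ → S) (t : ℤ) => u (t + h) :=
  measurable_pi_lambda _ fun _ => measurable_pi_apply _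

/-- The sequence of pairs of two sequences. -/
def zipPath (z : ℤ → S) (e : ℤ → R) : ℤ → S × R := fun t => (z t, e t)

lemma measurable_zipPath : Measurable fun q : (ℤ → S) × (ℤ → R) => zipPath q.1 q.2 :=
  measurable_pi_lambda _ fun t => ((measurable_pi_apply t).comp measurable_fst).prodMk
    ((measurable_pi_apply t).comp measurable_snd)

lemma map_pair_shift (hZ : ∀ t, Measurable (Z t)) (hε : ∀ t, Measurable (ε t))
    (hZs : IsStationary μ Z) (hεs : IsStationary μ ε) (hZε : IndepFun (path Z) (path ε) μ)
    (h : ℤ) :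
    μ.map (fun ω => (path (fun t => Z (t + h)) ω, path (fun t => ε (t + h)) ω))
      = μ.map (fun ω => (path Z ω, path ε ω)) := by
  have h1 : IndepFun (path fun t => Z (t + h)) (path fun t => ε (t + h)) μ :=
    hZε.comp (φ := fun (u : ℤ → S) (t : ℤ) => u (t + h))
      (ψ := fun (u : ℤ → R) (t : ℤ) => u (t + h)) (measurable_shiftBy h)
      (measurable_shiftBy h)
  have hZh := (measurable_path fun t => hZ (t + h)).aemeasurable (μ := μ)
  have hεh := (measurable_path fun t => hε (t + h)).aemeasurable (μ := μ)
  rw [(indepFun_iff_map_prod_eq_prod_map_map hZh hεh).1 h1,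
    (indepFun_iff_map_prod_eq_prod_map_map (measurable_path hZ).aemeasurable
      (measurable_path hε).aemeasurable).1 hZε, hZs h, hεs h]

lemma isStationary_zip (hZ : ∀ t, Measurable (Z t)) (hε : ∀ t, Measurable (ε t))
    (hZs : IsStationary μ Z) (hεs : IsStationary μ ε) (hZε : IndepFun (path Z) (path ε) μ) :
    IsStationary μ (fun t ω => (Z t ω, ε t ω)) := by
  intro h
  have := congrArg (Measure.map fun q : (ℤ → S) × (ℤ → R) => zipPath q.1 q.2)
    (map_pair_shift hZ hε hZs hεs hZε h)
  rwa [Measure.map_map measurable_zipPath ((measurable_path fun t => hZ (t + h)).prodMk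
    (measurable_path fun t => hε (t + h))), Measure.map_map measurable_zipPath
      ((measurable_path hZ).prodMk (measurable_path hε))] at this

lemma measureReal_path_shift (hY : ∀ t, Measurable (ε t)) (hs : IsStationary μ ε) (h : ℤ)
    {A : Set (ℤ → R)} (hA : MeasurableSet A) :
    μ.real {ω | path (fun t => ε (t + h)) ω ∈ A} = μ.real {ω | path ε ω ∈ A} := by
  have := congrArg (fun ν => ν A) (hs h)
  simp only [Measure.map_apply (measurable_path fun t => hY (t + h)) hA,
    Measure.map_apply (measurable_path hY) hA] at this
  exact congrArg ENNReal.toReal this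

/-- The probability of a set of joint trajectories, given the trajectory of the first process. -/
noncomputable def sectionProb (μ : Measure Ω) (ε : ℤ → Ω → R) (J : Set (ℤ → S × R))
    (z : ℤ → S) : ℝ :=
  μ.real {ω | zipPath z (path ε ω) ∈ J}

lemma measurable_sectionProb (hε : ∀ t, Measurable (ε t)) {J : Set (ℤ → S × R)}
    (hJ : MeasurableSet J) : Measurable (sectionProb μ ε J) := by
  have hm : Measurable fun q : (ℤ → S) × Ω => zipPath q.1 (path ε q.2) :=
    measurable_zipPath.comp (measurable_fst.prodMk ((measurable_path hε).comp measurable_snd))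
  exact (measurable_measure_prodMk_left (ν := μ) (hm hJ)).ennreal_toReal

lemma sectionProb_mem_Icc (J : Set (ℤ → S × R)) (z : ℤ → S) :
    sectionProb μ ε J z ∈ Set.Icc 0 1 :=
  ⟨measureReal_nonneg, measureReal_le_one⟩

lemma integrable_of_mem_Icc {f : Ω → ℝ} (hf : Measurable f) (h : ∀ ω, f ω ∈ Set.Icc 0 1) :
    Integrable f μ :=
  (integrable_const (1 : ℝ)).mono' hf.aestronglyMeasurable (ae_of_all _ fun ω => by
    rw [Real.norm_eq_abs, abs_of_nonneg (h ω).1]; exact (h ω).2)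

lemma measurableSet_section (hε : ∀ t, Measurable (ε t)) {J : Set (ℤ → S × R)}
    (hJ : MeasurableSet J) (z : ℤ → S) : MeasurableSet {ω | zipPath z (path ε ω) ∈ J} :=
  (measurable_zipPath.comp (measurable_const.prodMk (measurable_path hε))) hJ

lemma integral_sectionProb (hZ : ∀ t, Measurable (Z t)) (hε : ∀ t, Measurable (ε t))
    (hZε : IndepFun (path Z) (path ε) μ) {J : Set (ℤ → S × R)} (hJ : MeasurableSet J) :
    ∫ ω, sectionProb μ ε J (path Z ω) ∂μ = μ.real {ω | zipPath (path Z ω) (path ε ω) ∈ J} := by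
  have hm := (measurable_sectionProb (μ := μ) hε hJ).comp (measurable_path hZ)
  have hJ' := measurable_zipPath hJ
  have h1 := lintegral_comp_of_indepFun (measurable_path hZ) (measurable_path hε) hZε
    (G := ((fun q : (ℤ → S) × (ℤ → R) => zipPath q.1 q.2) ⁻¹' J).indicator 1)
    (measurable_one.indicator hJ')
  rw [integral_eq_lintegral_of_nonneg_ae (ae_of_all _ fun ω => (sectionProb_mem_Icc _ _).1)
    hm.aestronglyMeasurable]
  congr 1
  have h2 : μ {ω | zipPath (path Z ω) (path ε ω) ∈ J}
      = ∫⁻ ω, ((fun q : (ℤ → S) × (ℤ → R) => zipPath q.1 q.2) ⁻¹' J).indicator 1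
          (path Z ω, path ε ω) ∂μ :=
    (lintegral_indicator_one (((measurable_path hZ).prodMk (measurable_path hε)) hJ')).symm
  rw [h2, h1]
  refine lintegral_congr fun ω => ?_
  rw [sectionProb, measureReal_def, ENNReal.ofReal_toReal (measure_ne_top _ _)]
  exact (lintegral_indicator_one (measurableSet_section hε hJ _)).symm

lemma exists_shift_disjoint (s : Finset ℤ) : ∃ m : ℕ, ∀ i ∈ s, i + (m : ℤ) ∉ s := by
  obtain ⟨a, ha⟩ := s.bddAbove
  obtain ⟨b, hb⟩ := s.bddBelow
  refine ⟨(a - b + 1).toNat, fun i hi hi' => ?_⟩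
  have h1 := ha hi'
  have h2 := hb hi
  have h3 := Int.self_le_toNat (a - b + 1)
  linarith

/-- Translating the pair amounts to translating `z` alone, because the law of `ε` is invariant. -/
lemma sectionProb_shift (hε : ∀ t, Measurable (ε t)) (hεs : IsStationary μ ε)
    {J : Set (ℤ → S × R)} (hJ : MeasurableSet J) (h : ℤ) (z : ℤ → S) :
    μ.real {ω | (fun t => zipPath z (path ε ω) (t + h)) ∈ J}
      = sectionProb μ ε J (fun t => z (t + h)) :=
  measureReal_path_shift hε hεs h (A := {e | zipPath (fun t => z (t + h)) e ∈ J})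
    ((measurable_zipPath.comp (measurable_const.prodMk measurable_id)) hJ)

lemma measurableSet_section_cylinder {m : MeasurableSpace Ω} {s : Finset ℤ} {C : Set (s → S × R)}
    (hC : MeasurableSet C) (k : ℤ) (y : ℤ → S) (hε : ∀ i ∈ s, Measurable (ε (i + k))) :
    MeasurableSet {ω | (fun t => zipPath y (path ε ω) (t + k)) ∈ cylinder s C} := by
  have : Measurable fun ω (i : s) => (y (i + k), ε (i + k) ω) :=
    measurable_pi_lambda _ fun i => measurable_const.prodMk (hε i i.2)
  exact this hC

/-- Two cylinders over disjoint sets of times are independent given the first process. -/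
lemma sectionProb_cylinder_inter (hε : ∀ t, Measurable (ε t)) (hεindep : iIndepFun ε μ)
    (hεs : IsStationary μ ε) {s : Finset ℤ} {C : Set (s → S × R)}
    (hC : MeasurableSet C) {m : ℤ} (hm : ∀ i ∈ s, i + m ∉ s) (z : ℤ → S) :
    sectionProb μ ε (cylinder s C ∩ {w | (fun t => w (t + m)) ∈ cylinder s C}) z
      = sectionProb μ ε (cylinder s C) z * sectionProb μ ε (cylinder s C) fun t => z (t + m) := by
  have hJ : MeasurableSet (cylinder s C) := MeasurableSet.cylinder (α := fun _ => S × R) s hC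
  have hind := indep_iSup_of_disjoint (m := fun j => MeasurableSpace.comap (ε j) inferInstance)
    (fun j => (hε j).comap_le) hεindep (S := (s : Set ℤ)) (T := (fun i => i + m) '' (s : Set ℤ))
    (by
      rw [Set.disjoint_right]
      rintro _ ⟨i, hi, rfl⟩
      exact hm i hi)
  rw [← sectionProb_shift hε hεs hJ m z]
  have h1 (A : Set ℤ) (k : ℤ) (hk : ∀ i ∈ s, i + k ∈ A) (y : ℤ → S) :
      MeasurableSet[⨆ j ∈ A, MeasurableSpace.comap (ε j) inferInstance]
        {ω | (fun t => zipPath y (path ε ω) (t + k)) ∈ cylinder s C} := by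
    exact measurableSet_section_cylinder hC k y fun i hi =>
      measurable_iff_comap_le.2 (le_iSup₂_of_le (i + k) (hk i hi) le_rfl)
  have h2 := (Indep_iff _ _ _).1 hind _ _
    (h1 (s : Set ℤ) 0 (fun i hi => by simpa using hi) z) (h1 ((fun i => i + m) '' (s : Set ℤ)) m (fun i hi => ⟨i, hi, rfl⟩) z)
  simp only [add_zero] at h2
  have h3 := congrArg ENNReal.toReal h2
  rw [ENNReal.toReal_mul] at h3
  exact h3

lemma sectionProb_shift_invariant (hε : ∀ t, Measurable (ε t)) (hεs : IsStationary μ ε)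
    {I : Set (ℤ → S × R)} (hI : MeasurableSet I) (hinv : shift ⁻¹' I = I) :
    sectionProb μ ε I ∘ shift = sectionProb μ ε I := by
  ext z
  have h1 := sectionProb_shift hε hεs hI 1 z
  have h2 : {ω | (fun t => zipPath z (path ε ω) (t + 1)) ∈ I}
      = {ω | zipPath z (path ε ω) ∈ I} := by
    ext ω
    exact Set.ext_iff.1 hinv (zipPath z (path ε ω))
  rw [h2] at h1
  exact h1.symm

lemma preimage_shiftBy_of_invariant {I : Set (ℤ → R)} (hinv : shift ⁻¹' I = I) (m : ℕ)
    (w : ℤ → R) : (fun t => w (t + m)) ∈ I ↔ w ∈ I := by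
  induction m with
  | zero => simp
  | succ m ih =>
    have e : (fun t : ℤ => w (t + (m + 1 : ℕ))) = shift fun t => w (t + m) := by
      ext t
      simp only [shift]
      congr 1
      push_cast
      ring
    rw [← ih, e, ← Set.mem_preimage, hinv]

lemma integral_path_shift (hZ : ∀ t, Measurable (Z t)) (hZs : IsStationary μ Z)
    {f : (ℤ → S) → ℝ} (hf : Measurable f) (h : ℤ) :
    ∫ ω, f (path (fun t => Z (t + h)) ω) ∂μ = ∫ ω, f (path Z ω) ∂μ := by
  rw [← integral_map (measurable_path hZ).aemeasurable hf.aestronglyMeasurable, ← hZs h,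
    integral_map (measurable_path fun t => hZ (t + h)).aemeasurable hf.aestronglyMeasurable]

/-- The quantitative zero-one law: an invariant set whose conditional probability is the
constant `c` and which is approximated by a cylinder satisfies `c ≈ c ^ 2`. -/
lemma abs_sub_sq_le_of_approx (hZ : ∀ t, Measurable (Z t)) (hε : ∀ t, Measurable (ε t))
    (hZs : IsStationary μ Z) (hεindep : iIndepFun ε μ) (hεs : IsStationary μ ε)
    (hZε : IndepFun (path Z) (path ε) μ) {I : Set (ℤ → S × R)} (hI : MeasurableSet I)
    (hinv : shift ⁻¹' I = I) {c : ℝ} (hc : ∀ᵐ ω ∂μ, sectionProb μ ε I (path Z ω) = c)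
    {s : Finset ℤ} {C : Set (s → S × R)} (hC : MeasurableSet C) {η : ℝ}
    (hη : μ.real {ω | zipPath (path Z ω) (path ε ω) ∈ I ∆ cylinder s C} ≤ η) :
    |c - c * c| ≤ 4 * η := by
  obtain ⟨m, hm⟩ := exists_shift_disjoint s
  set J : Set (ℤ → S × R) := cylinder s C
  have hJ : MeasurableSet J := MeasurableSet.cylinder (α := fun _ => S × R) s hC
  have hJm : MeasurableSet {w : ℤ → S × R | (fun t => w (t + m)) ∈ J} := measurable_shiftBy m hJ
  have hIJ : MeasurableSet (I ∆ J) := hI.symmDiff hJ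
  have hZm (h : ℤ) := measurable_path fun t => hZ (t + h)
  have hφ := measurable_sectionProb (μ := μ) hε hJ
  have hφI := integral_sectionProb hZ hε hZε hI
  have hc1 : μ.real {ω | zipPath (path Z ω) (path ε ω) ∈ I} = c := by
    rw [← hφI, integral_congr_ae hc]; simp
  have hc01 : c ∈ Set.Icc (0 : ℝ) 1 := hc1 ▸ ⟨measureReal_nonneg, measureReal_le_one⟩
  have hφint (h : ℤ) : Integrable (fun ω => sectionProb μ ε J (path (fun t => Z (t + h)) ω)) μ :=
    integrable_of_mem_Icc (hφ.comp (hZm h)) fun ω => sectionProb_mem_Icc _ _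
  -- the conditional probability of the cylinder is close to `c`
  have hX : ∫ ω, |sectionProb μ ε J (path Z ω) - c| ∂μ ≤ η := by
    refine le_trans ?_ hη
    rw [← integral_sectionProb hZ hε hZε hIJ]
    refine integral_mono_ae ?_ ?_ (hc.mono fun ω hω => ?_)
    · exact ((integrable_of_mem_Icc (hφ.comp (measurable_path hZ)) fun ω =>
        sectionProb_mem_Icc _ _).sub (integrable_const c)).abs
    · exact integrable_of_mem_Icc ((measurable_sectionProb hε hIJ).comp (measurable_path hZ))
        fun ω => sectionProb_mem_Icc _ _
    · dsimp only
      rw [← hω, abs_sub_comm]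
      exact abs_measureReal_sub_le_measureReal_symmDiff (measurableSet_section hε hI _).nullMeasurableSet
        (measurableSet_section hε hJ _).nullMeasurableSet
  have hX' : ∫ ω, |sectionProb μ ε J (path (fun t => Z (t + m)) ω) - c| ∂μ ≤ η := by
    rwa [integral_path_shift hZ hZs (f := fun u => |sectionProb μ ε J u - c|)
      (hφ.sub_const c).norm]
  have hprod : μ.real {ω | zipPath (path Z ω) (path ε ω) ∈
      J ∩ {w | (fun t => w (t + m)) ∈ J}}
      = ∫ ω, sectionProb μ ε J (path Z ω)
          * sectionProb μ ε J (path (fun t => Z (t + m)) ω) ∂μ := by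
    rw [← integral_sectionProb hZ hε hZε (hJ.inter hJm)]
    exact integral_congr_ae (ae_of_all _ fun ω =>
      sectionProb_cylinder_inter hε hεindep hεs hC hm _)
  have h1 : |(∫ ω, sectionProb μ ε J (path Z ω)
      * sectionProb μ ε J (path (fun t => Z (t + m)) ω) ∂μ) - c * c| ≤ 2 * η := by
    have hi0 := hφint 0
    simp only [add_zero] at hi0
    have hi : Integrable (fun ω => sectionProb μ ε J (path Z ω)
        * sectionProb μ ε J (path (fun t => Z (t + m)) ω)) μ :=
      integrable_of_mem_Icc ((hφ.comp (measurable_path hZ)).mul (hφ.comp (hZm m))) fun ω =>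
        ⟨mul_nonneg (sectionProb_mem_Icc _ _).1 (sectionProb_mem_Icc _ _).1,
          mul_le_one₀ (sectionProb_mem_Icc _ _).2 (sectionProb_mem_Icc _ _).1
            (sectionProb_mem_Icc _ _).2⟩
    have hcc : ∫ _, c * c ∂μ = c * c := by simp
    rw [← hcc, ← integral_sub hi (integrable_const _)]
    refine abs_integral_le_integral_abs.trans ?_
    have hA := (hi0.sub (integrable_const c)).abs
    have hB := ((hφint m).sub (integrable_const c)).abs
    calc _ ≤ ∫ ω, (|sectionProb μ ε J (path Z ω) - c|
          + |sectionProb μ ε J (path (fun t => Z (t + m)) ω) - c|) ∂μ := by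
          refine integral_mono (hi.sub (integrable_const _)).abs (hA.add hB) fun ω => ?_
          dsimp only
          generalize hx : sectionProb μ ε J (path Z ω) = x
          generalize hy : sectionProb μ ε J (path (fun t => Z (t + m)) ω) = y
          have hy1 : y ∈ Set.Icc (0 : ℝ) 1 := hy ▸ sectionProb_mem_Icc _ _
          rw [show x * y - c * c = (x - c) * y + c * (y - c) by ring]
          refine (abs_add_le _ _).trans (add_le_add ?_ ?_)
          · rw [abs_mul, abs_of_nonneg hy1.1]
            exact mul_le_of_le_one_right (abs_nonneg _) hy1.2
          · rw [abs_mul, abs_of_nonneg hc01.1]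
            exact mul_le_of_le_one_left (abs_nonneg _) hc01.2
      _ = _ := integral_add hA hB
      _ ≤ 2 * η := by linarith
  have hpair : Measurable fun ω => zipPath (path Z ω) (path ε ω) :=
    measurable_zipPath.comp ((measurable_path hZ).prodMk (measurable_path hε))
  -- Since `I` is invariant, its difference from `J` intersected with its translate lies in `I ∆ J`
  -- together with the translate of `I ∆ J`, and both have probability at most `η` by stationarity.
  have h2 : |μ.real {ω | zipPath (path Z ω) (path ε ω) ∈ I}
      - μ.real {ω | zipPath (path Z ω) (path ε ω) ∈ J ∩ {w | (fun t => w (t + m)) ∈ J}}|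
      ≤ 2 * η := by
    refine (abs_measureReal_sub_le_measureReal_symmDiff (hpair hI).nullMeasurableSet
      (hpair (hJ.inter hJm)).nullMeasurableSet).trans ?_
    have hs := measureReal_path_shift (μ := μ) (fun t => (hZ t).prodMk (hε t))
      (isStationary_zip hZ hε hZs hεs hZε) m hIJ
    refine (measureReal_mono (s₂ := {ω | zipPath (path Z ω) (path ε ω) ∈ I ∆ J}
      ∪ {ω | path (fun t ω => (Z (t + m) ω, ε (t + m) ω)) ω ∈ I ∆ J}) ?_).trans
        ((measureReal_union_le _ _).trans ?_)
    · intro ω hω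
      have hiff := preimage_shiftBy_of_invariant hinv m (zipPath (path Z ω) (path ε ω))
      have e : (path (fun t ω => (Z (t + m) ω, ε (t + m) ω)) ω)
        = fun t : ℤ => zipPath (path Z ω) (path ε ω) (t + m) := rfl
      simp only [Set.mem_symmDiff, Set.mem_union, Set.mem_ofPred_eq, Set.mem_preimage, Set.mem_inter_iff,
        e] at hω ⊢
      tauto
    · have hs' : μ.real {ω | path (fun t ω => (Z (t + m) ω, ε (t + m) ω)) ω ∈ I ∆ J} ≤ η :=
        hs.le.trans hη
      linarith
  rw [hprod, hc1] at h2
  calc |c - c * c| ≤ _ := abs_sub_le _ _ _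
    _ ≤ 4 * η := by linarith

/-- A stationary ergodic process and an independent i.i.d. process are jointly ergodic. -/
theorem isStationaryErgodic_zip (hZ : ∀ t, Measurable (Z t)) (hε : ∀ t, Measurable (ε t))
    (hZerg : IsStationaryErgodic μ Z) (hεindep : iIndepFun ε μ)
    (hεident : ∀ t, IdentDistrib (ε t) (ε 0) μ μ) (hZε : IndepFun (path Z) (path ε) μ) :
    IsStationaryErgodic μ (fun t ω => (Z t ω, ε t ω)) := by
  have hεs := isStationary_of_iid hε hεindep hεident
  have hW := isStationary_zip hZ hε hZerg.1 hεs hZε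
  have hWm : ∀ t, Measurable fun ω => (Z t ω, ε t ω) := fun t => (hZ t).prodMk (hε t)
  have hWp := measurable_path hWm
  have hprob : IsProbabilityMeasure (μ.map (path fun t ω => (Z t ω, ε t ω))) :=
    Measure.isProbabilityMeasure_map hWp.aemeasurable
  refine ⟨hW, ⟨measurable_shift, ?_⟩, ⟨fun I hI hinv => ?_⟩⟩
  · rw [Measure.map_map measurable_shift hWp]
    exact hW 1
  -- The conditional probability of `I` given `Z` is a shift-invariant function of `Z`, hence almost
  -- surely constant.
  obtain ⟨c, hc⟩ := hZerg.2.toPreErgodic.ae_eq_const_of_ae_eq_comp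
    (measurable_sectionProb (μ := μ) hε hI) (sectionProb_shift_invariant hε hεs hI hinv)
  have hc' : ∀ᵐ ω ∂μ, sectionProb μ ε I (path Z ω) = c :=
    ae_of_ae_map (measurable_path hZ).aemeasurable hc
  have hdense := Measure.MeasureDense.of_generateFrom_isSetAlgebra_finite
    (μ := μ.map (path fun t ω => (Z t ω, ε t ω)))
    (isSetAlgebra_measurableCylinders (α := fun _ : ℤ => S × R))
    generateFrom_measurableCylinders.symm
  have hcc : |c - c * c| ≤ 0 := by
    refine le_of_forall_pos_le_add fun η hη => ?_
    obtain ⟨J, hJ, hIJ⟩ := hdense.approx I hI (measure_ne_top _ _) (η / 4) (by positivity)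
    obtain ⟨s, C, hC, rfl⟩ := (mem_measurableCylinders _).1 hJ
    have hm : MeasurableSet (I ∆ cylinder s C) :=
      hI.symmDiff (MeasurableSet.cylinder (α := fun _ => S × R) s hC)
    rw [Measure.map_apply hWp hm] at hIJ
    have := abs_sub_sq_le_of_approx hZ hε hZerg.1 hεindep hεs hZε hI hinv hc' hC (η := η / 4)
      (ENNReal.toReal_le_of_le_ofReal (by positivity) hIJ.le)
    linarith
  have hc1 : μ.real {ω | zipPath (path Z ω) (path ε ω) ∈ I} = c := by
    rw [← integral_sectionProb hZ hε hZε hI, integral_congr_ae hc']; simp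
  have hmass : (μ.map (path fun t ω => (Z t ω, ε t ω))).real I = c := by
    rw [measureReal_def, Measure.map_apply hWp hI]
    exact hc1
  have h01 : c * (1 - c) = 0 := by
    have := abs_nonpos_iff.1 hcc
    linarith
  rw [eventuallyConst_set]
  rcases mul_eq_zero.1 h01 with h | h
  · right
    rw [h, measureReal_eq_zero_iff] at hmass
    exact measure_eq_zero_iff_ae_notMem.1 hmass
  · left
    rw [show c = 1 by linarith] at hmass
    rw [measureReal_def, ENNReal.toReal_eq_one_iff] at hmass
    exact (mem_ae_iff_prob_eq_one hI).2 hmass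

end JointErgodicity

namespace IsContractiveModel

variable {Ω E E₁ E₂ : Type*} {mΩ : MeasurableSpace Ω} {μ : Measure Ω} [IsProbabilityMeasure μ]
  [MetricSpace E] [SecondCountableTopology E] [CompleteSpace E]
  [MeasurableSpace E] [BorelSpace E] [MeasurableSpace E₁] [MeasurableSpace E₂]
  {F : E → E₁ → E₂ → E} {Z : ℤ → Ω → E₁} {ε : ℤ → Ω → E₂} {p : ℝ} {K : E₁ → ℝ≥0∞} {x₀ : E}

/-! ### Ergodicity of the limit, a factor of the ergodic pair of covariates and innovations. -/

section Factor

/-- The map that sends a trajectory of covariates and innovations to the trajectory of limits of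
the backward iterations and covariates. -/
noncomputable def limFactor (F : E → E₁ → E₂ → E) (x₀ : E) (w : ℤ → E₁ × E₂) : ℤ → E × E₁ :=
  fun t => (limIter F (fun j (w : ℤ → E₁ × E₂) => (w j).1) (fun j w => (w j).2) x₀ t w, (w t).1)

lemma limFactor_path (F : E → E₁ → E₂ → E) (Z : ℤ → Ω → E₁) (ε : ℤ → Ω → E₂) (x₀ : E) :
    path (fun t ω => (limIter F Z ε x₀ t ω, Z t ω))
      = limFactor F x₀ ∘ path (fun t ω => (Z t ω, ε t ω)) := by
  ext ω t : 2
  refine Prod.ext (limIter_congr ?_ ?_ x₀ t) rfl <;> exact fun _ => rfl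

lemma limFactor_shiftBy (F : E → E₁ → E₂ → E) (x₀ : E) (h : ℤ) (w : ℤ → E₁ × E₂) :
    limFactor F x₀ (fun t => w (t + h)) = fun t => limFactor F x₀ w (t + h) := by
  ext t : 1
  refine Prod.ext ?_ rfl
  simp only [limFactor]
  rw [← limIter_shift]
  refine limIter_congr ?_ ?_ x₀ t <;> exact fun _ => rfl

lemma measurable_limFactor (hF : Measurable fun q : E × E₁ × E₂ => F q.1 q.2.1 q.2.2) (x₀ : E) :
    Measurable (limFactor F x₀) :=
  measurable_pi_lambda _ fun t => (ExoMaps.measurable_limIter hF x₀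
    (fun j _ => (measurable_pi_apply j).fst) (fun j _ => (measurable_pi_apply j).snd)).prodMk
      (measurable_pi_apply t).fst

lemma isStationaryErgodic_limIter (h : IsContractiveModel μ F Z ε p K)
    (hZerg : IsStationaryErgodic μ Z) (x₀ : E) :
    IsStationaryErgodic μ (fun t ω => (limIter F Z ε x₀ t ω, Z t ω)) := by
  have hΦ := measurable_limFactor h.measurable_map x₀
  have hWm : ∀ t, Measurable fun ω => (Z t ω, ε t ω) := fun t =>
    (h.measurable_cov t).prodMk (h.measurable_innov t)
  obtain ⟨hs, he⟩ := isStationaryErgodic_zip h.measurable_cov h.measurable_innov hZerg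
    h.iIndepFun_innov h.identDistrib_innov h.indepFun_cov_innov
  constructor
  · intro k
    have e : path (fun t ω => (limIter F Z ε x₀ (t + k) ω, Z (t + k) ω))
        = limFactor F x₀ ∘ path (fun t ω => (Z (t + k) ω, ε (t + k) ω)) := by
      ext ω : 1
      have h1 := limFactor_shiftBy F x₀ k (path (fun t ω => (Z t ω, ε t ω)) ω)
      have h2 := congrFun (limFactor_path F Z ε x₀) ω
      exact (h1.trans (congrArg (fun (u : ℤ → E × E₁) (t : ℤ) => u (t + k)) h2.symm)).symm
    have h3 := congrArg (Measure.map (limFactor F x₀)) (hs k)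
    rw [Measure.map_map hΦ (measurable_path fun t => hWm (t + k)),
      Measure.map_map hΦ (measurable_path hWm), ← e, ← limFactor_path] at h3
    exact h3
  · rw [limFactor_path, ← Measure.map_map hΦ (measurable_path hWm)]
    exact (hΦ.measurePreserving _).ergodic_of_ergodic_semiconj he measurable_shift
      fun w => limFactor_shiftBy F x₀ 1 w

end Factor

/-! ### Transfer of the quenched results to random covariates. -/

section Annealed

variable {t : ℤ}

/-- The covariate at time `j`, as a function of the pair of trajectories. -/
def covCoord (j : ℤ) (q : (ℤ → E₁) × (ℤ → E₂)) : E₁ := q.1 j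

/-- The innovation at time `j`, as a function of the pair of trajectories. -/
def innovCoord (j : ℤ) (q : (ℤ → E₁) × (ℤ → E₂)) : E₂ := q.2 j

lemma backIter_coord (z : ℤ → E₁) (x : E) (s : ℕ) (t : ℤ) (ω : Ω) :
    backIter F covCoord innovCoord x s t (z, path ε ω) = backIter F (fun t _ => z t) ε x s t ω := by
  refine backIter_congr ?_ ?_ x s t <;> exact fun _ => rfl

lemma limIter_coord (z : ℤ → E₁) (x : E) (t : ℤ) (ω : Ω) :
    limIter F covCoord innovCoord x t (z, path ε ω) = limIter F (fun t _ => z t) ε x t ω := by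
  refine limIter_congr ?_ ?_ x t <;> exact fun _ => rfl

lemma backIter_path (x : E) (s : ℕ) (t : ℤ) (ω : Ω) :
    backIter F (fun t _ => path Z ω t) ε x s t ω = backIter F Z ε x s t ω := by
  refine backIter_congr ?_ ?_ x s t <;> exact fun _ => rfl

lemma limIter_path (x : E) (t : ℤ) (ω : Ω) :
    limIter F (fun t _ => path Z ω t) ε x t ω = limIter F Z ε x t ω := by
  refine limIter_congr ?_ ?_ x t <;> exact fun _ => rfl

lemma measurable_covCoord (j : ℤ) : Measurable (covCoord (E₁ := E₁) (E₂ := E₂) j) :=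
  (measurable_pi_apply j).comp measurable_fst

lemma measurable_innovCoord (j : ℤ) : Measurable (innovCoord (E₁ := E₁) (E₂ := E₂) j) :=
  (measurable_pi_apply j).comp measurable_snd

lemma measurable_backIter_coord (h : IsContractiveModel μ F Z ε p K) (x : E) (s : ℕ) (t : ℤ) :
    Measurable (backIter F (covCoord (E₁ := E₁) (E₂ := E₂)) innovCoord x s t) :=
  measurable_backIter h.measurable_map measurable_const s
    (fun j _ => measurable_covCoord j) (fun j _ => measurable_innovCoord j)

lemma measurable_limIter_coord (h : IsContractiveModel μ F Z ε p K) (x : E) (t : ℤ) :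
    Measurable (limIter F (covCoord (E₁ := E₁) (E₂ := E₂)) innovCoord x t) :=
  ExoMaps.measurable_limIter h.measurable_map _
    (fun j _ => measurable_covCoord j) (fun j _ => measurable_innovCoord j)

lemma ae_tendsto_limIter_annealed (h : IsContractiveModel μ F Z ε p K)
    (hgood : ∀ᵐ ω ∂μ, IsSummablePath μ F ε p K x₀ (path Z ω) t) (x : E) :
    ∀ᵐ ω ∂μ, Tendsto (fun s => backIter F Z ε x s t ω) atTop (𝓝 (limIter F Z ε x₀ t ω)) := by
  have hA := measurableSet_tendsto_fun (l := atTop)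
    (fun s => h.measurable_backIter_coord x s t) (h.measurable_limIter_coord x₀ t)
  filter_upwards [ae_of_ae_ae_of_indepFun h.measurable_cov h.measurable_innov
    h.indepFun_cov_innov hA (hgood.mono fun ω hω => (h.ae_tendsto_limIter hω x).mono
      fun ω' hω' => by simpa only [Set.mem_ofPred_eq, backIter_coord, limIter_coord] using hω')]
    with ω hω
  simpa only [Set.mem_ofPred_eq, backIter_coord, limIter_coord, backIter_path, limIter_path]
    using hω

lemma ae_limIter_eq_rmap_annealed (h : IsContractiveModel μ F Z ε p K)
    (hgood : ∀ᵐ ω ∂μ, IsSummablePath μ F ε p K x₀ (path Z ω) t)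
    (hgood' : ∀ᵐ ω ∂μ, IsSummablePath μ F ε p K x₀ (path Z ω) (t - 1)) :
    ∀ᵐ ω ∂μ, limIter F Z ε x₀ t ω = rmap F Z ε t ω (limIter F Z ε x₀ (t - 1) ω) := by
  have hL := h.measurable_limIter_coord x₀
  have hA : MeasurableSet {q | limIter F covCoord innovCoord x₀ t q
      = rmap F covCoord innovCoord t q (limIter F covCoord innovCoord x₀ (t - 1) q)} :=
    measurableSet_eq_fun (hL t) (h.measurable_map.comp ((hL (t - 1)).prodMk
      ((measurable_covCoord (t - 1)).prodMk (measurable_innovCoord t))))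
  filter_upwards [ae_of_ae_ae_of_indepFun h.measurable_cov h.measurable_innov
    h.indepFun_cov_innov hA ((hgood.and hgood').mono fun ω hω =>
      (h.ae_limIter_eq_rmap hω.1 hω.2).mono fun ω' hω' => by
        simp only [Set.mem_ofPred_eq, limIter_coord]; exact hω')] with ω hω
  simp only [limIter_coord, limIter_path] at hω
  exact hω

lemma measurable_lintegral_limIter {Ω' : Type*} {mΩ' : MeasurableSpace Ω'}
    (h : IsContractiveModel μ F Z ε p K) {ζ : ℤ → Ω' → E₁} (hζ : ∀ j ≤ t - 1, Measurable (ζ j)) :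
    Measurable fun ω => ∫⁻ ω', edist (limIter F (fun j _ => ζ j ω) ε x₀ t ω') x₀ ^ p ∂μ := by
  have h1 : Measurable (limIter F (fun j (q : Ω' × Ω) => ζ j q.1) (fun j q => ε j q.2) x₀ t) :=
    ExoMaps.measurable_limIter h.measurable_map _ (fun j hj => (hζ j hj).comp measurable_fst)
      (fun j _ => (h.measurable_innov j).comp measurable_snd)
  have h2 (ω : Ω') (ω' : Ω) : limIter F (fun j _ => ζ j ω) ε x₀ t ω'
      = limIter F (fun j (q : Ω' × Ω) => ζ j q.1) (fun j q => ε j q.2) x₀ t (ω, ω') := by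
    refine limIter_congr ?_ ?_ x₀ t <;> exact fun _ => rfl
  simp only [h2]
  exact ((h1.edist measurable_const).pow_const p).lintegral_prod_right' (ν := μ)

/-- The limit at time `t` involves covariates only up to `t - 1`, so its frozen moment is measurable
for any `m` containing these; this covers both the full path and the past of `Z`. -/
lemma ae_condLExp_limIter_lt_top (h : IsContractiveModel μ F Z ε p K)
    (hgood : ∀ᵐ ω ∂μ, IsSummablePath μ F ε p K x₀ (path Z ω) t)
    (hmom : ∀ z, ∫⁻ ω, edist (F x₀ z (ε 1 ω)) x₀ ^ p ∂μ < ∞) {m : MeasurableSpace Ω}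
    (hm : m ≤ fullSigma Z) (hZm : ∀ j ≤ t - 1, Measurable[m] (Z j)) :
    ∀ᵐ ω ∂μ, condLExp m μ (fun ω' => edist (limIter F Z ε x₀ t ω') x₀ ^ p) ω < ∞ := by
  have hG : Measurable fun q : (ℤ → E₁) × (ℤ → E₂) =>
      edist (limIter F covCoord innovCoord x₀ t q) x₀ ^ p :=
    ((h.measurable_limIter_coord x₀ t).edist measurable_const).pow_const p
  have hq := measurable_lintegral_limIter (mΩ' := m) (x₀ := x₀) h hZm
  have h1 := condLExp_eq_of_indepFun h.measurable_cov h.measurable_innov h.indepFun_cov_innov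
    hm hG (by simp only [limIter_coord]; exact hq)
  simp only [limIter_coord, limIter_path] at h1
  filter_upwards [h1, hgood] with ω hω hg
  exact (le_of_eq hω.symm).trans_lt (h.lintegral_limIter_lt_top hg hmom)

lemma ae_tendsto_condLExp_limIter (h : IsContractiveModel μ F Z ε p K)
    (hgood : ∀ᵐ ω ∂μ, IsSummablePath μ F ε p K x₀ (path Z ω) t) (x : E) :
    ∀ᵐ ω ∂μ, Tendsto (fun s => condLExp (fullSigma Z) μ
      (fun ω' => edist (backIter F Z ε x s t ω') (limIter F Z ε x₀ t ω') ^ p) ω) atTop (𝓝 0) := by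
  have hG (s : ℕ) : Measurable fun q : (ℤ → E₁) × (ℤ → E₂) =>
      edist (backIter F covCoord innovCoord x s t q) (limIter F covCoord innovCoord x₀ t q) ^ p :=
    ((h.measurable_backIter_coord x s t).edist (h.measurable_limIter_coord x₀ t)).pow_const p
  have hq (s : ℕ) : Measurable[fullSigma Z] fun ω => ∫⁻ ω',
      edist (backIter F covCoord innovCoord x s t (path Z ω, path ε ω'))
        (limIter F covCoord innovCoord x₀ t (path Z ω, path ε ω')) ^ p ∂μ := by
    have h1 : Measurable fun z : ℤ → E₁ => ∫⁻ ω',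
        edist (backIter F covCoord innovCoord x s t (z, path ε ω'))
          (limIter F covCoord innovCoord x₀ t (z, path ε ω')) ^ p ∂μ :=
      ((hG s).comp (measurable_fst.prodMk
        ((measurable_path h.measurable_innov).comp measurable_snd))).lintegral_prod_right' (ν := μ)
    rw [fullSigma_eq_comap]
    exact h1.comp (comap_measurable (path Z))
  have h1 := fun s => condLExp_eq_of_indepFun h.measurable_cov h.measurable_innov
    h.indepFun_cov_innov le_rfl (hG s) (hq s)
  simp only [backIter_coord, limIter_coord, backIter_path, limIter_path] at h1
  filter_upwards [ae_all_iff.2 h1, hgood] with ω hω hg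
  refine Tendsto.congr (fun s => hω s) ?_
  exact tendsto_lintegral_rpow_of_lpMean h.one_le (h.tendsto_lpMean_limIter hg x)

end Annealed

/-! ### Existence and uniqueness of the stationary solution. -/

section Solution

lemma isStationarySolution_limIter (h : IsContractiveModel μ F Z ε p K)
    (hZerg : IsStationaryErgodic μ Z)
    (hgood : ∀ t, ∀ᵐ ω ∂μ, IsSummablePath μ F ε p K x₀ (path Z ω) t)
    (hmom : ∀ z, ∫⁻ ω, edist (F x₀ z (ε 1 ω)) x₀ ^ p ∂μ < ∞) :
    IsStationarySolution μ F Z ε p x₀ (limIter F Z ε x₀) where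
  nonanticipative t := by
    have hW {j : ℤ} (hj : j ≤ t) :
        Measurable[pastSigma (fun j ω => (Z j ω, ε j ω)) t] fun ω => (Z j ω, ε j ω) :=
      measurable_pastSigma _ hj
    exact ExoMaps.measurable_limIter h.measurable_map _
      (fun j hj => measurable_fst.comp (hW (hj.trans (by omega))))
      (fun j hj => measurable_snd.comp (hW hj))
  stationary := (h.isStationaryErgodic_limIter hZerg x₀).1
  recursion t := h.ae_limIter_eq_rmap_annealed (hgood t) (hgood (t - 1))
  moment := h.ae_condLExp_limIter_lt_top (hgood 0) hmom (pastSigma_le_fullSigma Z 0)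
    fun _ hj => measurable_pastSigma Z (by omega)

lemma ae_eq_backIter_of_recursion {Y : ℤ → Ω → E}
    (hY : ∀ t, ∀ᵐ ω ∂μ, Y t ω = rmap F Z ε t ω (Y (t - 1) ω)) (s : ℕ) (t : ℤ) :
    ∀ᵐ ω ∂μ, Y t ω = backIter F Z ε (Y (t - s - 1) ω) s t ω := by
  induction s generalizing t with
  | zero => simpa [backIter] using hY t
  | succ s ih =>
    filter_upwards [hY t, ih (t - 1)] with ω h1 h2
    rw [backIter, show t - ((s + 1 : ℕ) : ℤ) - 1 = t - 1 - s - 1 by push_cast; ring, ← h2, h1]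

lemma measurable_coeffProd (h : IsContractiveModel μ F Z ε p K) (t : ℤ) (s : ℕ) :
    Measurable[fullSigma Z] fun ω => coeffProd K (path Z ω) t s := by
  unfold coeffProd
  exact Finset.measurable_fun_prod _ fun j _ =>
    h.measurable_coeff.comp (measurable_fullSigma Z (t - 1 - j))

/-- From two starting points that are at a distance at most `M`, the backward iterations are close
with a high probability where the product of the coefficients is small. -/
lemma measure_edist_backIter_le (h : IsContractiveModel μ F Z ε p K) (s : ℕ) (t : ℤ)
    {U V : Ω → E} (hU : Measurable[jointSigma Z ε (t - s - 1)] U)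
    (hV : Measurable[jointSigma Z ε (t - s - 1)] V) {M δ η : ℝ≥0∞}
    (hUV : ∀ ω, edist (U ω) (V ω) ≤ M) :
    η ^ p * μ {ω | coeffProd K (path Z ω) t s ≤ δ ∧
      η ≤ edist (backIter F Z ε (U ω) s t ω) (backIter F Z ε (V ω) s t ω)} ≤ (δ * M) ^ p := by
  have hp0 : 0 ≤ p := by linarith [h.one_le]
  have hle : jointSigma Z ε (t - s - 1) ≤ mΩ :=
    sup_le (fullSigma_le h.measurable_cov) (pastSigma_le h.measurable_innov _)
  have hb {U : Ω → E} (hU : Measurable[jointSigma Z ε (t - s - 1)] U) :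
      Measurable fun ω => backIter F Z ε (U ω) s t ω :=
    measurable_backIter h.measurable_map (hU.mono hle le_rfl) s (fun j _ => h.measurable_cov j)
      (fun j _ => h.measurable_innov j)
  -- This event depends on the covariates only, so its indicator is an admissible weight in the
  -- contraction estimate; Markov's inequality then gives the bound.
  let B : Set Ω := {ω | coeffProd K (path Z ω) t s ≤ δ}
  have hB : MeasurableSet[fullSigma Z] B := h.measurable_coeffProd t s measurableSet_Iic
  have hw : Measurable[fullSigma Z] (B.indicator (1 : Ω → ℝ≥0∞)) :=
    (@measurable_one _ _ _ (fullSigma Z) _).indicator hB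
  have h1 := h.lintegral_backIter_le s t hw hU hV
  have h2 := mul_meas_ge_le_lintegral (μ := μ) (((hw.mono (fullSigma_le h.measurable_cov) le_rfl).mul
    (((hb hU).edist (hb hV)).pow_const p))) (η ^ p)
  refine le_trans ?_ (h2.trans (h1.trans ?_))
  · gcongr η ^ p * μ ?_
    rintro ω ⟨h3, h4⟩
    have : ω ∈ B := h3
    simp only [Set.mem_ofPred_eq, Set.indicator_of_mem this, Pi.one_apply, one_mul, Pi.mul_apply]
    exact ENNReal.rpow_le_rpow h4 hp0
  · calc _ ≤ ∫⁻ _, (δ * M) ^ p ∂μ := by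
          refine lintegral_mono fun ω => ?_
          by_cases hω : ω ∈ B
          · simp only [Set.indicator_of_mem hω, Pi.one_apply, one_mul]
            rw [ENNReal.mul_rpow_of_nonneg _ _ hp0]
            gcongr
            · exact hω
            · exact hUV ω
          · simp [Set.indicator_of_notMem hω]
      _ = (δ * M) ^ p := by simp

lemma tendsto_measure_lt_coeffProd (h : IsContractiveModel μ F Z ε p K) {t : ℤ}
    (hgood : ∀ᵐ ω ∂μ, IsSummablePath μ F ε p K x₀ (path Z ω) t) {δ : ℝ≥0∞} (hδ : δ ≠ 0) :
    Tendsto (fun s => μ {ω | δ < coeffProd K (path Z ω) t s}) atTop (𝓝 0) := by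
  have hm (s : ℕ) : MeasurableSet {ω | δ < coeffProd K (path Z ω) t s} :=
    fullSigma_le h.measurable_cov _ (h.measurable_coeffProd t s measurableSet_Ioi)
  simp only [← lintegral_indicator_one (hm _)]
  rw [← lintegral_zero (μ := μ)]
  refine tendsto_lintegral_of_dominated_convergence 1
    (fun s => measurable_one.indicator (hm s))
    (fun s => ae_of_all _ fun ω => Set.indicator_le_self _ _ ω) (by simp) ?_
  filter_upwards [hgood] with ω hω
  refine tendsto_const_nhds.congr' ?_
  filter_upwards [(ENNReal.tendsto_atTop_zero_of_tsum_ne_top hω.1).eventually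
    (ge_mem_nhds (pos_iff_ne_zero.2 hδ))] with s hs
  rw [Set.indicator_of_notMem]
  simpa using hs

lemma tendsto_measure_nat_lt_edist {Y : Ω → E} (hY : Measurable Y) (x₀ : E) :
    Tendsto (fun M : ℕ => μ {ω | (M : ℝ≥0∞) < edist (Y ω) x₀}) atTop (𝓝 0) := by
  have hm (M : ℕ) : MeasurableSet {ω | (M : ℝ≥0∞) < edist (Y ω) x₀} :=
    measurableSet_lt measurable_const (hY.edist measurable_const)
  simp only [← lintegral_indicator_one (hm _)]
  rw [← lintegral_zero (μ := μ)]
  refine tendsto_lintegral_of_dominated_convergence 1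
    (fun s => measurable_one.indicator (hm s))
    (fun s => ae_of_all _ fun ω => Set.indicator_le_self _ _ ω) (by simp) ?_
  refine ae_of_all _ fun ω => tendsto_const_nhds.congr' ?_
  obtain ⟨N, hN⟩ := ENNReal.exists_nat_gt (edist_ne_top (Y ω) x₀)
  filter_upwards [eventually_ge_atTop N] with M hM
  rw [Set.indicator_of_notMem]
  simpa using hN.le.trans (by exact_mod_cast hM)

/-- Every non-anticipative stationary solution is the limit of the backward iterations. -/
lemma ae_eq_limIter_of_isStationarySolution (h : IsContractiveModel μ F Z ε p K)
    (hgood : ∀ t, ∀ᵐ ω ∂μ, IsSummablePath μ F ε p K x₀ (path Z ω) t) {Y : ℤ → Ω → E}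
    (hY : IsStationarySolution μ F Z ε p x₀ Y) (t : ℤ) :
    ∀ᵐ ω ∂μ, Y t ω = limIter F Z ε x₀ t ω := by
  have hp := h.one_le
  have hYj (u : ℤ) : Measurable[jointSigma Z ε u] (Y u) := by
    refine (hY.nonanticipative u).mono (iSup₂_le fun j hj => ?_) le_rfl
    rw [← measurable_iff_comap_le]
    exact ((measurable_fullSigma Z j).mono le_sup_left le_rfl).prodMk
      ((measurable_pastSigma ε hj).mono le_sup_right le_rfl)
  have hYm (u : ℤ) : Measurable (Y u) := (hYj u).mono
    (sup_le (fullSigma_le h.measurable_cov) (pastSigma_le h.measurable_innov _)) le_rfl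
  have hstat (M : ℕ) (u : ℤ) : μ {ω | (M : ℝ≥0∞) < edist (Y u ω) x₀}
      = μ {ω | (M : ℝ≥0∞) < edist (Y 0 ω) x₀} := by
    have hp (u : ℤ) : Measurable fun ω => (Y u ω, Z u ω) := (hYm u).prodMk (h.measurable_cov u)
    have hA : MeasurableSet {w : ℤ → E × E₁ | (M : ℝ≥0∞) < edist (w 0).1 x₀} :=
      measurableSet_lt measurable_const ((measurable_pi_apply 0).fst.edist measurable_const)
    have h1 := congrArg (fun ν => ν {w : ℤ → E × E₁ | (M : ℝ≥0∞) < edist (w 0).1 x₀})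
      (hY.stationary u)
    simp only [Measure.map_apply (measurable_path fun t => hp (t + u)) hA,
      Measure.map_apply (measurable_path hp) hA] at h1
    simpa [path] using h1
  have hlim := h.ae_tendsto_limIter_annealed (hgood t) x₀
  have hconv : TendstoInMeasure μ (fun s => backIter F Z ε x₀ s t) atTop (Y t) := by
    refine tendstoInMeasure_of_ne_top fun η hη hηtop => ?_
    rw [ENNReal.tendsto_nhds_zero]
    intro θ' hθ'
    -- One share of `θ` for each bad event: the remote starting point is far from `x₀`, the product
    -- of coefficients is not small, or the iterates are far apart despite both.
    obtain ⟨θ, hθ0, hθ⟩ : ∃ θ : ℝ≥0∞, θ ≠ 0 ∧ θ + (θ + θ) ≤ θ' :=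
      ⟨θ' / 3, by simpa using hθ'.ne', by rw [← add_assoc, ENNReal.add_thirds]⟩
    obtain ⟨M, hM, hM1⟩ := (((ENNReal.tendsto_nhds_zero.1
      (tendsto_measure_nat_lt_edist (μ := μ) (hYm 0) x₀)) θ (pos_iff_ne_zero.2 hθ0)).and
        (eventually_ge_atTop 1)).exists
    have hM0 : (M : ℝ≥0∞) ≠ 0 := by simp; omega
    have hηp0 : η ^ p ≠ 0 := by simp [ENNReal.rpow_eq_zero_iff, hη.ne', hηtop]
    have hηptop : η ^ p ≠ ∞ := ENNReal.rpow_ne_top_of_nonneg (by linarith) hηtop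
    -- Chosen so that `(δ * M) ^ p = η ^ p * θ`, which makes the Markov bound exactly `θ`.
    set δ : ℝ≥0∞ := (θ * η ^ p) ^ (1 / p) / M with hδdef
    have hδM : (δ * M) ^ p = η ^ p * θ := by
      rw [hδdef, ENNReal.div_mul_cancel hM0 (ENNReal.natCast_ne_top M), ← ENNReal.rpow_mul,
        one_div_mul_cancel (by linarith), ENNReal.rpow_one, mul_comm]
    have hδ : δ ≠ 0 := by
      intro h0
      rw [h0, zero_mul, ENNReal.zero_rpow_of_pos (by linarith)] at hδM
      exact mul_ne_zero hηp0 hθ0 hδM.symm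
    filter_upwards [(ENNReal.tendsto_nhds_zero.1
      (h.tendsto_measure_lt_coeffProd (hgood t) hδ)) θ (pos_iff_ne_zero.2 hθ0)] with s hs
    refine le_trans ?_ hθ
    set u : ℤ := t - s - 1 with hu
    classical
    -- Truncation gives a starting point within `M` of `x₀` for every `ω`, while keeping the
    -- measurability that makes it independent of the later innovations.
    let V : Ω → E := fun ω => if edist (Y u ω) x₀ ≤ M then Y u ω else x₀
    have hτ : Measurable fun y : E => if edist y x₀ ≤ M then y else x₀ :=
      Measurable.ite (measurableSet_le (measurable_id.edist measurable_const) measurable_const)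
        measurable_id measurable_const
    have hV : Measurable[jointSigma Z ε u] V := hτ.comp (hYj u)
    have hVM (ω : Ω) : edist x₀ (V ω) ≤ M := by
      by_cases hω : edist (Y u ω) x₀ ≤ M
      · simp [V, hω, edist_comm x₀]
      · simp [V, hω]
    have h3 := h.measure_edist_backIter_le s t (U := fun _ => x₀) measurable_const hV
      (δ := δ) (η := η) hVM
    rw [hδM, ENNReal.mul_le_mul_iff_right hηp0 hηptop] at h3
    have hsub : {ω | η ≤ edist (backIter F Z ε x₀ s t ω) (Y t ω)}
        ≤ᵐ[μ] ({ω | (M : ℝ≥0∞) < edist (Y u ω) x₀} ∪ ({ω | δ < coeffProd K (path Z ω) t s} ∪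
          {ω | coeffProd K (path Z ω) t s ≤ δ ∧
            η ≤ edist (backIter F Z ε x₀ s t ω) (backIter F Z ε (V ω) s t ω)}) : Set Ω) := by
      filter_upwards [ae_eq_backIter_of_recursion hY.recursion s t] with ω hω hη'
      by_cases h4 : edist (Y u ω) x₀ ≤ M
      · right
        rcases lt_or_ge δ (coeffProd K (path Z ω) t s) with h5 | h5
        · exact Or.inl h5
        · refine Or.inr ⟨h5, ?_⟩
          have h6 : V ω = Y u ω := if_pos h4
          rw [h6, ← hω]
          exact hη'
      · exact Or.inl (not_le.1 h4)
    refine (measure_mono_ae hsub).trans ((measure_union_le _ _).trans (add_le_add ?_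
      ((measure_union_le _ _).trans (add_le_add hs h3))))
    -- Stationarity makes one `M` serve for every starting time `u = t - s - 1`.
    rw [hstat]
    exact hM
  have hconv' : TendstoInMeasure μ (fun s => backIter F Z ε x₀ s t) atTop (limIter F Z ε x₀ t) :=
    tendstoInMeasure_of_tendsto_ae
      (fun s => (h.measurable_backIter_const x₀ s t).aestronglyMeasurable) hlim
  exact tendstoInMeasure_ae_unique hconv hconv'

end Solution

end IsContractiveModel

end ExoMaps

/-! ### Assembly of the theorem. -/

theorem mainTheorem5
    {Ω : Type*} [MeasurableSpace Ω] (μ : Measure Ω) [IsProbabilityMeasure μ]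
    {E : Type*} [MetricSpace E] [CompleteSpace E] [SecondCountableTopology E]
    [MeasurableSpace E] [BorelSpace E]
    (e : ℕ) (E₁ : Set (EuclideanSpace ℝ (Fin e))) (_hE₁ : MeasurableSet E₁)
    {E₂ : Type*} [TopologicalSpace E₂] [PolishSpace E₂] [MeasurableSpace E₂] [BorelSpace E₂]
    (F : E → E₁ → E₂ → E)
    (_hF : Measurable fun q : E × E₁ × E₂ => F q.1 q.2.1 q.2.2)
    (Z : ℤ → Ω → E₁) (_hZ : ∀ t, Measurable (Z t))
    (ε : ℤ → Ω → E₂) (_hε : ∀ t, Measurable (ε t))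
    (p : ℝ) (_hp : 1 ≤ p) (x₀ : E)
    -- `Z` is stationary and ergodic, `ε` is i.i.d. and independent of `Z`
    (_hZerg : ExoMaps.IsStationaryErgodic μ Z)
    (_hεindep : iIndepFun ε μ) (_hεident : ∀ t, IdentDistrib (ε t) (ε 0) μ μ)
    (_hZε : IndepFun (ExoMaps.path Z) (ExoMaps.path ε) μ)
    -- moment of one step from `x₀`
    (_hmom : ∀ z : E₁, ∫⁻ ω, edist (F x₀ z (ε 1 ω)) x₀ ^ p ∂μ < ∞)
    -- contraction with a coefficient that depends on the covariate
    (κ : E₁ → ℝ) (_hκ : Measurable κ) (_hκpos : ∀ z, 0 < κ z)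
    (_hκlog : Integrable (fun ω => Real.posLog (κ (Z 0 ω))) μ)
    (_hκneg : ExoMaps.extMean μ (fun ω => Real.log (κ (Z 0 ω))) < 0)
    (_hcontr : ∀ (z : E₁) (x y : E),
      ∫⁻ ω, edist (F x z (ε 0 ω)) (F y z (ε 0 ω)) ^ p ∂μ
        ≤ ENNReal.ofReal (κ z) ^ p * edist x y ^ p)
    (_hlog : Integrable (fun ω => Real.posLog
      (∫⁻ u, edist x₀ (F x₀ (Z 0 ω) u) ^ p ∂(μ.map (ε 1))).toReal) μ) :
    ∃ X : E → ℤ → Ω → E,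
      (∀ x t, Measurable (X x t)) ∧
      -- conditional `p`-th moment and convergence of the backward iterations
      (∀ x t,
        (∀ᵐ ω ∂μ, condLExp (ExoMaps.fullSigma Z) μ
          (fun ω' => edist (X x t ω') x₀ ^ p) ω < ∞) ∧
        (∀ᵐ ω ∂μ, Tendsto (fun s : ℕ => condLExp (ExoMaps.fullSigma Z) μ
          (fun ω' => edist (ExoMaps.backIter F Z ε x s t ω') (X x t ω') ^ p) ω)
          atTop (𝓝 0)) ∧
        (∀ᵐ ω ∂μ, Tendsto (fun s : ℕ => ExoMaps.backIter F Z ε x s t ω)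
          atTop (𝓝 (X x t ω)))) ∧
      -- the limit does not depend on the starting point
      (∀ x y, x ≠ y → ∀ t, μ {ω | X x t ω ≠ X y t ω} = 0) ∧
      -- stationarity and ergodicity
      (∀ x, ExoMaps.IsStationaryErgodic μ (fun t ω => (X x t ω, Z t ω))) ∧
      -- the limit is a solution, and it is the only one in its class
      (∀ x, ExoMaps.IsStationarySolution μ F Z ε p x₀ (X x)) ∧
      (∀ Y : ℤ → Ω → E, ExoMaps.IsStationarySolution μ F Z ε p x₀ Y →
        ∀ x t, ∀ᵐ ω ∂μ, Y t ω = X x t ω) := by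
  have hF1 (z : E₁) : Measurable fun u : E₂ => edist x₀ (F x₀ z u) ^ p := by
    have : Measurable fun u : E₂ => F x₀ z u :=
      _hF.comp (g := fun q : E × E₁ × E₂ => F q.1 q.2.1 q.2.2)
        (f := fun u => (x₀, z, u)) (by fun_prop)
    exact (measurable_const.edist this).pow_const p
  have hmom (z : E₁) : ∫⁻ ω, edist x₀ (F x₀ z (ε 1 ω)) ^ p ∂μ ≠ ∞ := by
    simpa only [edist_comm x₀] using (_hmom z).ne
  have h : ExoMaps.IsContractiveModel μ F Z ε p (fun z => ENNReal.ofReal (κ z)) :=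
    { measurable_map := _hF
      measurable_cov := _hZ
      measurable_innov := _hε
      iIndepFun_innov := _hεindep
      identDistrib_innov := _hεident
      indepFun_cov_innov := _hZε
      one_le := _hp
      measurable_coeff := _hκ.ennreal_ofReal
      coeff_ne_top := fun _ => ENNReal.ofReal_ne_top
      contraction := _hcontr }
  simp only [lintegral_map (hF1 _) (_hε 1)] at _hlog
  have hgood := ExoMaps.ae_isSummablePath _hF _hZ _hε _hp _hZerg _hκ _hκpos _hκlog _hκneg hmom _hlog
  -- The limit from `x₀` is taken as `X x` for every `x`, so independence of the starting point is
  -- immediate and its content lies in the convergence of the iterates from `x` to that limit.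
  refine ⟨fun _ => ExoMaps.limIter F Z ε x₀, fun _ t => h.measurable_limIter x₀ t,
    fun x t => ⟨?_, h.ae_tendsto_condLExp_limIter (hgood t) x,
      h.ae_tendsto_limIter_annealed (hgood t) x⟩, fun _ _ _ _ => by simp,
    fun _ => h.isStationaryErgodic_limIter _hZerg x₀,
    fun _ => h.isStationarySolution_limIter _hZerg hgood _hmom,
    fun Y hY _ t => h.ae_eq_limIter_of_isStationarySolution hgood hY t⟩
  exact h.ae_condLExp_limIter_lt_top (hgood t) _hmom le_rfl
    fun j _ => ExoMaps.measurable_fullSigma Z j
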